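/- Let $n\ge 1$ and let $\mathbb{H}^n=\mathbb{C}^n\times\mathbb{R}$, with coordinates $(z,t)$, carry its standard CR structure $T_{1,0}$, spanned by $Z_\alpha=\frac{\partial}{\partial z_\alpha}+\sqrt{-1}\,\overline z_\alpha\frac{\partial}{\partial t}$ $(1\le\alpha\le n)$, and its standard contact form $\theta_0=dt+\sqrt{-1}\sum_{i=1}^n(z_i\,d\overline z_i-\overline z_i\,dz_i)$. For a contact form $\theta=e^{2u}\theta_0$ with $u$ smooth and real-valued, let $T$ be the characteristic direction of $\theta$ ($\theta(T)=1$, $d\theta(T,\cdot)=0$), let $R_\theta$ and $A_{\alpha\beta}$ be the Tanaka–Webster scalar curvature and the pseudohermitian torsion of $\theta$, and let $f_{\alpha\beta}=Z_\beta Z_\alpha f-\omega_\alpha{}^\gamma(Z_\beta)Z_\gamma f$ be the second covariant derivatives of $f$ with respect to the Tanaka–Webster connection $\omega_\alpha{}^\gamma$ of $\theta$, all components being taken in the frame $\{Z_\alpha\}$ (rescaling each $Z_\alpha$ by a nowhere zero function does not affect what follows). For a smooth real-valued function $f$ and a real constant $\mu$, the triple $(\mathbb{H}^n,\theta,f)$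 is called a CR Yamabe soliton with constant $\mu$ if $$R_\theta+\tfrac12\,Tf=\mu\qquad\text{and}\qquad f_{\alpha\alpha}+\sqrt{-1}\,A_{\alpha\alpha}f=0\quad\text{for all }\alpha=1,\dots,n.$$ Suppose that $(\mathbb{H}^n,e^{2u}\theta_0,f)$ is a CR Yamabe soliton with constant $\mu$ and that $u$ depends only on $t$. Then there are complex constants $C_{p_1q_1\cdots p_nq_n}$, $p_i,q_i\in\{0,1\}$, such that for all $(z,t)\in\mathbb{H}^n$ $$f(z,t)=2\mu\int_0^t e^{2u(s)}\,ds+\sum_{p_i,q_i\in\{0,1\}}C_{p_1q_1\cdots p_nq_n}\,z_1^{p_1}\overline z_1^{\,q_1}\cdots z_n^{p_n}\overline z_n^{\,q_n},$$ where $u(s)$ denotes the value of $u$ at the points with $t=s$. (The sum is real-valued, since $f$ and the integral are.) -/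

import Mathlib

open scoped ContDiff ComplexConjugate ComplexOrder

namespace HeisenbergCR

noncomputable section

/-- The manifold underlying the Heisenberg group `ℍⁿ`: points are `(z, t)` with `z ∈ ℂⁿ`, `t ∈ ℝ`.
It is a real vector space of dimension `2n + 1`, so all its tangent spaces are identified with it. -/
abbrev Heis (n : ℕ) : Type := (Fin n → ℂ) × ℝ

/-- Complexified tangent vectors: the pair `(X, Y)` stands for `X + √-1 Y`. -/
abbrev CVec (n : ℕ) : Type := Heis n × Heis n

/-- Complex conjugation of complexified tangent vectors. -/
def CVec.bar {n : ℕ} (V : CVec n) : CVec n := (V.1, -V.2)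

/-- Complex valued differential 1-forms on `ℍⁿ` (smoothness is required separately). -/
abbrev Form (n : ℕ) : Type := Heis n → Heis n →L[ℝ] ℂ

/-- Complex linear extension of a complex valued covector to complexified tangent vectors. -/
def ev {n : ℕ} (η : Heis n →L[ℝ] ℂ) (V : CVec n) : ℂ := η V.1 + Complex.I * η V.2

/-- Complex bilinear extension of a complex valued function of two tangent vectors. -/
def ev₂ {n : ℕ} (b : Heis n → Heis n → ℂ) (V W : CVec n) : ℂ :=
  b V.1 W.1 - b V.2 W.2 + Complex.I * (b V.1 W.2 + b V.2 W.1)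

/-- Exterior derivative of a 1-form: `dη(v, w) = (D_v η)(w) - (D_w η)(v)`. -/
def d {n : ℕ} (η : Form n) (p v w : Heis n) : ℂ :=
  fderiv ℝ η p v w - fderiv ℝ η p w v

/-- `d` is the exterior derivative of Mathlib. -/
theorem d_eq_extDeriv {n : ℕ} (η : Form n) (p v w : Heis n) :
    d η p v w = extDeriv (fun q => ContinuousAlternatingMap.ofSubsingleton ℝ (Heis n) ℂ (0 : Fin 1)
      (η q)) p ![v, w] := by
  rw [extDeriv, show (fun q => ContinuousAlternatingMap.ofSubsingleton ℝ (Heis n) ℂ (0 : Fin 1)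
      (η q)) = (ContinuousAlternatingMap.ofSubsingletonLIE (𝕜 := ℝ) (E := Heis n) (F := ℂ) (0 : Fin 1)) ∘ η from rfl]
  rw [LinearIsometryEquiv.comp_fderiv]
  simp [ContinuousAlternatingMap.alternatizeUncurryFin_apply, d, Fin.sum_univ_two, Fin.removeNth]
  rw [← sub_eq_add_neg]

/-- Wedge product of two covectors: `(a ∧ b)(v, w) = a(v) b(w) - a(w) b(v)`. -/
def wedge {n : ℕ} (a b : Heis n →L[ℝ] ℂ) (v w : Heis n) : ℂ := a v * b w - a w * b v

/-- A real covector, regarded as a complex valued one. -/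
def toC {n : ℕ} (η : Heis n →L[ℝ] ℝ) : Heis n →L[ℝ] ℂ := Complex.ofRealCLM.comp η

/-- The conjugate of a complex valued covector. -/
def conjForm {n : ℕ} (η : Heis n →L[ℝ] ℂ) : Heis n →L[ℝ] ℂ :=
  (Complex.conjCLE : ℂ →L[ℝ] ℂ).comp η

/-- The covector `dz_i`. -/
def dz (n : ℕ) (i : Fin n) : Heis n →L[ℝ] ℂ :=
  (ContinuousLinearMap.proj i).comp (ContinuousLinearMap.fst ℝ (Fin n → ℂ) ℝ)

/-- The standard contact form `θ₀ = dt + √-1 ∑ (z_i dz̄_i - z̄_i dz_i)`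
(the sum is real, see `contactForm_apply`). -/
def contactForm (n : ℕ) (p : Heis n) : Heis n →L[ℝ] ℝ :=
  ContinuousLinearMap.snd ℝ (Fin n → ℂ) ℝ +
    Complex.reCLM.comp (Complex.I • ∑ i, (p.1 i • conjForm (dz n i) - conj (p.1 i) • dz n i))

theorem contactForm_apply {n : ℕ} (p v : Heis n) :
    (contactForm n p v : ℂ) =
      v.2 + Complex.I * ∑ i, (p.1 i * conj (v.1 i) - conj (p.1 i) * v.1 i) := by
  have key : ((Complex.I * ∑ i, (p.1 i * conj (v.1 i) - conj (p.1 i) * v.1 i)).re : ℂ) =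
      Complex.I * ∑ i, (p.1 i * conj (v.1 i) - conj (p.1 i) * v.1 i) := by
    rw [← Complex.conj_eq_iff_re]
    simp only [map_mul, map_sum, map_sub, Complex.conj_I, Complex.conj_conj, neg_mul]
    rw [← mul_neg, ← Finset.sum_neg_distrib]
    simp only [neg_sub]
  rw [← key]
  simp [contactForm, conjForm, dz]

/-- The standard frame `Z_α = ∂/∂z_α + √-1 z̄_α ∂/∂t` of the CR structure `T_{1,0}` of `ℍⁿ`,
where `∂/∂z_α = (∂/∂x_α - √-1 ∂/∂y_α) / 2`. The real part is `(1/2) ∂/∂x_α + y_α ∂/∂t` and the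
imaginary part is `-(1/2) ∂/∂y_α + x_α ∂/∂t`. -/
def Z {n : ℕ} (α : Fin n) (p : Heis n) : CVec n :=
  ((Pi.single α (1 / 2), (p.1 α).im), (Pi.single α (-(Complex.I / 2)), (p.1 α).re))

theorem ev_dz_Z {n : ℕ} (i α : Fin n) (p : Heis n) :
    ev (dz n i) (Z α p) = if i = α then 1 else 0 := by
  by_cases h : i = α
  · subst h
    simp [ev, dz, Z]
    ring_nf
    simp
    norm_num
  · simp [ev, dz, Z, h]

theorem ev_dz_bar_Z {n : ℕ} (i α : Fin n) (p : Heis n) :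
    ev (dz n i) (Z α p).bar = 0 := by
  by_cases h : i = α
  · subst h
    simp [ev, dz, Z, CVec.bar]
    ring_nf
    simp
  · simp [ev, dz, Z, CVec.bar, h]

theorem ev_contactForm_Z {n : ℕ} (α : Fin n) (p : Heis n) :
    ev (toC (contactForm n p)) (Z α p) = 0 := by
  have h1 : ∀ v, toC (contactForm n p) v = _ := fun v => contactForm_apply p v
  rw [ev, h1, h1]
  simp only [Z]
  rw [Finset.sum_eq_single α (fun b _ hb => by simp [hb]) (by simp),
    Finset.sum_eq_single α (fun b _ hb => by simp [hb]) (by simp)]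
  simp only [Pi.single_eq_same]
  have h2 : conj (p.1 α) = (p.1 α).re - (p.1 α).im * Complex.I := by
    apply Complex.ext <;> simp
  have h3 : p.1 α = (p.1 α).re + (p.1 α).im * Complex.I := (Complex.re_add_im _).symm
  have h4 : conj (1 / 2 : ℂ) = 1 / 2 := by simp [Complex.conj_ofNat]
  have h5 : conj (-(Complex.I / 2)) = Complex.I / 2 := by simp [Complex.conj_ofNat, neg_div]
  rw [h4, h5]
  linear_combination ((p.1 α).im + Complex.I * (p.1 α).re) * Complex.I_sq +
    (Complex.I / 2 + Complex.I ^ 3 / 2) * h3 + (-Complex.I / 2 + Complex.I ^ 3 / 2) * h2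

/-- The derivative `V φ` of a complex valued function along a complex vector field. -/
def deriv {n : ℕ} (V : Heis n → CVec n) (φ : Heis n → ℂ) (p : Heis n) : ℂ :=
  ev (fderiv ℝ φ p) (V p)

/-- The matrix `h_{αβ̄} = -√-1 dθ(Z_α, Z_β̄)` of the Levi form of `θ` in the frame `Z_α`. -/
def levi {n : ℕ} (θ : Heis n → Heis n →L[ℝ] ℝ) (p : Heis n) : Matrix (Fin n) (Fin n) ℂ :=
  fun α β => -Complex.I * ev₂ (d (fun q => toC (θ q)) p) (Z α p) (Z β p).bar

/-- `θ` is a strictly pseudoconvex pseudohermitian structure (contact form) for the standard CR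
structure of `ℍⁿ`: a smooth real 1-form annihilating `T_{1,0}` whose Levi form is positive
definite. -/
structure IsPseudohermitian {n : ℕ} (θ : Heis n → Heis n →L[ℝ] ℝ) : Prop where
  smooth : ContDiff ℝ ∞ θ
  annihilates : ∀ α p, ev (toC (θ p)) (Z α p) = 0
  levi_posDef : ∀ p, (levi θ p).PosDef

/-- `T` is the characteristic direction of `θ`, and `ϑ α = θ^α` is the admissible coframe dual to
the frame `{T, Z_α, Z_ᾱ}`. -/
structure IsAdmissibleCoframe {n : ℕ} (θ : Heis n → Heis n →L[ℝ] ℝ) (T : Heis n → Heis n)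
    (ϑ : Fin n → Form n) : Prop where
  smooth_T : ContDiff ℝ ∞ T
  smooth : ∀ α, ContDiff ℝ ∞ (ϑ α)
  theta_T : ∀ p, θ p (T p) = 1
  dtheta_T : ∀ p v, d (fun q => toC (θ q)) p (T p) v = 0
  coframe_T : ∀ α p, ϑ α p (T p) = 0
  coframe_Z : ∀ α β p, ev (ϑ α p) (Z β p) = if α = β then 1 else 0
  coframe_Zbar : ∀ α β p, ev (ϑ α p) (Z β p).bar = 0

/-- `τ_α = h_{αβ̄} τ^β̄`, where `τ α = τ^α`, `τ^ᾱ` is the conjugate of `τ^α`. -/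
def lower {n : ℕ} (θ : Heis n → Heis n →L[ℝ] ℝ) (τ : Fin n → Form n) (α : Fin n) : Form n :=
  fun p => ∑ β, levi θ p α β • conjForm (τ β p)

/-- `Γ α β = ω_α^β` are the Tanaka-Webster connection forms and `τ α = τ^α` the torsion forms of
`θ` in the frame `Z_α` with admissible coframe `ϑ α = θ^α`. These forms are uniquely determined by
the three equations
`dθ^α = θ^β ∧ ω_β^α + θ ∧ τ^α`, `dh_{αβ̄} = h_{αγ̄} ω_β̄^γ̄ + ω_α^γ h_{γβ̄}`, `τ_α ∧ θ^α = 0`. -/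
structure IsTanakaWebster {n : ℕ} (θ : Heis n → Heis n →L[ℝ] ℝ) (ϑ : Fin n → Form n)
    (Γ : Fin n → Fin n → Form n) (τ : Fin n → Form n) : Prop where
  smooth_connection : ∀ α β, ContDiff ℝ ∞ (Γ α β)
  smooth_torsion : ∀ α, ContDiff ℝ ∞ (τ α)
  structure_eq : ∀ α p v w, d (ϑ α) p v w =
    (∑ β, wedge (ϑ β p) (Γ β α p) v w) + wedge (toC (θ p)) (τ α p) v w
  metric_eq : ∀ α β p v, fderiv ℝ (fun q => levi θ q α β) p v =
    (∑ γ, levi θ p α γ * conj (Γ β γ p v)) + ∑ γ, Γ α γ p v * levi θ p γ β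
  torsion_eq : ∀ p v w, ∑ α, wedge (lower θ τ α p) (ϑ α p) v w = 0

/-- The pseudohermitian torsion `A_{αγ}`, defined by `τ_α = A_{αγ} θ^γ`. -/
def torsion {n : ℕ} (θ : Heis n → Heis n →L[ℝ] ℝ) (τ : Fin n → Form n) (α γ : Fin n)
    (p : Heis n) : ℂ :=
  ev (lower θ τ α p) (Z γ p)

/-- The curvature form `dω_β^α - ω_β^γ ∧ ω_γ^α`. -/
def curvForm {n : ℕ} (Γ : Fin n → Fin n → Form n) (β α : Fin n) (p v w : Heis n) : ℂ :=
  d (Γ β α) p v w - ∑ γ, wedge (Γ β γ p) (Γ γ α p) v w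

/-- The Tanaka-Webster curvature `R_β^α_{ρσ̄}`, the coefficient of `θ^ρ ∧ θ^σ̄` in the curvature
form. -/
def curvature {n : ℕ} (Γ : Fin n → Fin n → Form n) (β α ρ σ : Fin n) (p : Heis n) : ℂ :=
  ev₂ (curvForm Γ β α p) (Z ρ p) (Z σ p).bar

/-- The Tanaka-Webster Ricci curvature `R_{ρσ̄} = R_α^α_{ρσ̄}`. -/
def ricci {n : ℕ} (Γ : Fin n → Fin n → Form n) (p : Heis n) : Matrix (Fin n) (Fin n) ℂ :=
  fun ρ σ => ∑ α, curvature Γ α α ρ σ p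

/-- The Tanaka-Webster scalar curvature `R = h^{ρσ̄} R_{ρσ̄}`. -/
def scalarCurvature {n : ℕ} (θ : Heis n → Heis n →L[ℝ] ℝ) (Γ : Fin n → Fin n → Form n)
    (p : Heis n) : ℂ :=
  ∑ ρ, ∑ σ, (levi θ p)⁻¹ σ ρ * ricci Γ p ρ σ

/-- The second covariant derivative `f_{αβ} = Z_β Z_α f - ω_α^γ(Z_β) Z_γ f`. -/
def hess {n : ℕ} (Γ : Fin n → Fin n → Form n) (f : Heis n → ℝ) (α β : Fin n) (p : Heis n) : ℂ :=
  deriv (Z β) (deriv (Z α) (fun q => (f q : ℂ))) p -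
    ∑ γ, ev (Γ α γ p) (Z β p) * deriv (Z γ) (fun q => (f q : ℂ)) p

/-- `(ℍⁿ, θ, f)` is a CR Yamabe soliton with constant `μ`: the potential function `f` is smooth and
real valued, and
`R_θ + f_0 / 2 = μ`, `f_{αα} + √-1 A_{αα} f = 0` for all `α = 1, …, n`,
where `f_0 = T f`. Components are taken in the standard frame `Z_α`; the second equation is
unaffected when each `Z_α` is multiplied by a nowhere zero function (for instance by `e^{-u}`). -/
def IsCRYamabeSoliton {n : ℕ} (θ : Heis n → Heis n →L[ℝ] ℝ) (f : Heis n → ℝ) (μ : ℝ) : Prop :=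
  IsPseudohermitian θ ∧ ContDiff ℝ ∞ f ∧
    ∃ (T : Heis n → Heis n) (ϑ : Fin n → Form n) (Γ : Fin n → Fin n → Form n) (τ : Fin n → Form n),
      IsAdmissibleCoframe θ T ϑ ∧ IsTanakaWebster θ ϑ Γ τ ∧
      (∀ p, scalarCurvature θ Γ p + (1 / 2) * (fderiv ℝ f p (T p) : ℂ) = μ) ∧
      ∀ α p, hess Γ f α α p + Complex.I * torsion θ τ α α p * f p = 0

end

end HeisenbergCR

/-! Write `v` for the conformal exponent as a function of `t`. The structure equations, evaluated on
the frame `Z_α, Z_ᾱ, ∂/∂t`, determine every pseudohermitian quantity of `e^{2v} θ₀` that the soliton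
equations involve. With `E` the real Euler field in `z`, those equations become `(∂_t - v' E) f = 2μ
e^{2v} + 4(n+1)(v'' + n v'^2)|z|²` (`characteristic_pde`) and `Z_α Z_α (e^{-2v} f) = 0` (`hess_pde`,
`deriv_deriv_Z_conformal`).

The heart of the proof is that `v` must be constant. Put `g = e^{-2v} f`. As `g` is real, also `Z̄_α
Z̄_α g = 0`, and the relation `[Z_α, Z̄_α] = -2i ∂_t` then forces `∂_t (Z_α Z̄_α + Z̄_α Z_α) g = 0`
(`fderiv_Dt_sublaplacian`). On the other hand, integrating the first equation along its
characteristics (`eq_along_characteristics`) shows that on the axis `z = 0` this sublaplacian is a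
constant plus `2κ(t)`, where `κ' = 4(n+1) e^{-2v} (v'' + n v'^2)`. Hence `v'' + n v'^2 = 0` on all
of `ℝ`, so `e^{nv}` is affine and positive on the whole line, hence constant
(`deriv_eq_zero_of_ode`, `deriv_conformal_eq_zero`).

With `v` constant, the first equation integrates to `f(z,t) = 2μ ∫ e^{2v} + f(z,0)`, and `Z_α Z_α f
= 0` says that `f(·,0)` is a combination of `1, w, w̄, |w|²` in each complex variable separately
(`slice_eq`). Interpolating one variable at a time gives the multilinear sum
(`exists_coeff_of_separately_affine`). -/

namespace HeisenbergCR

variable {n : ℕ}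

/-! ### Calculus of forms and functions in the frame `Z_α, Z_ᾱ, ∂/∂t`. -/

theorem ev₂_wedge (a b : Heis n →L[ℝ] ℂ) (V W : CVec n) :
    ev₂ (wedge a b) V W = ev a V * ev b W - ev a W * ev b V := by
  simp only [ev₂, wedge, ev]
  linear_combination (b W.2 * a V.2 - a W.2 * b V.2) * (-Complex.I_sq)

theorem ev_conjForm (η : Heis n →L[ℝ] ℂ) (V : CVec n) :
    ev (conjForm η) V = conj (ev η V.bar) := by
  simp [ev, conjForm, CVec.bar]

theorem bar_bar (V : CVec n) : V.bar.bar = V := by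
  simp [CVec.bar]

/-- The vector field `∂/∂t` as a complexified tangent vector. -/
def Dt (n : ℕ) : CVec n := ((0, 1), 0)

theorem ev_Dt (η : Heis n →L[ℝ] ℂ) : ev η (Dt n) = η (0, 1) := by
  simp [ev, Dt]

theorem ev_dz_Dt (i : Fin n) : ev (dz n i) (Dt n) = 0 := by
  simp [ev, dz, Dt]

theorem ev_conj_dz_Z (i α : Fin n) (p : Heis n) : ev (conjForm (dz n i)) (Z α p) = 0 := by
  simp [ev_conjForm, ev_dz_bar_Z]

theorem ev_conj_dz_bar_Z (i α : Fin n) (p : Heis n) :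
    ev (conjForm (dz n i)) (Z α p).bar = if i = α then 1 else 0 := by
  rw [ev_conjForm, bar_bar, ev_dz_Z]
  split_ifs <;> simp

theorem ev_conj_dz_Dt (i : Fin n) : ev (conjForm (dz n i)) (Dt n) = 0 := by
  simp [ev, conjForm, dz, Dt]

theorem ev_Z (η : Heis n →L[ℝ] ℂ) (α : Fin n) (p : Heis n) :
    ev η (Z α p) = (η (Pi.single α 1, 0) - Complex.I * η (Pi.single α Complex.I, 0)) / 2 +
      Complex.I * conj (p.1 α) * η (0, 1) := by
  have h1 : (Z α p).1 = (1 / 2 : ℝ) • ((Pi.single α 1, 0) : Heis n) +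
      (p.1 α).im • ((0, 1) : Heis n) := by
    refine Prod.ext (funext fun i => ?_) ?_
    · by_cases h : i = α
      · subst h; simp [Z]
      · simp [Z, h]
    · simp [Z]
  have h2 : (Z α p).2 = (-1 / 2 : ℝ) • ((Pi.single α Complex.I, 0) : Heis n) +
      (p.1 α).re • ((0, 1) : Heis n) := by
    refine Prod.ext (funext fun i => ?_) ?_
    · by_cases h : i = α
      · subst h; simp [Z]; ring
      · simp [Z, h]
    · simp [Z]
  have h3 : conj (p.1 α) = (p.1 α).re - (p.1 α).im * Complex.I := by
    apply Complex.ext <;> simp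
  rw [ev, h1, h2, map_add, map_add, map_smul, map_smul, map_smul, map_smul, h3]
  simp only [Complex.real_smul]
  push_cast
  linear_combination ((p.1 α).im * η (0, 1)) * Complex.I_sq

theorem ev_bar_Z (η : Heis n →L[ℝ] ℂ) (α : Fin n) (p : Heis n) :
    ev η (Z α p).bar = (η (Pi.single α 1, 0) + Complex.I * η (Pi.single α Complex.I, 0)) / 2 -
      Complex.I * p.1 α * η (0, 1) := by
  have h := ev_conjForm (conjForm η) (Z α p).bar
  have h1 : conjForm (conjForm η) = η := by ext v <;> simp [conjForm]
  rw [h1, bar_bar, ev_Z] at h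
  rw [h]
  simp [conjForm, Complex.conj_ofNat]
  ring

/-- Expansion of a covector in the coframe dual to `Z_α`, `Z_ᾱ`, `∂/∂t`. -/
theorem form_apply_eq (η : Heis n →L[ℝ] ℂ) (p v : Heis n) :
    η v = ∑ γ, (v.1 γ * ev η (Z γ p) + conj (v.1 γ) * ev η (Z γ p).bar) +
      contactForm n p v * η (0, 1) := by
  have h1 : v = ∑ γ, ((v.1 γ).re • ((Pi.single γ 1, 0) : Heis n) +
      (v.1 γ).im • ((Pi.single γ Complex.I, 0) : Heis n)) + v.2 • ((0, 1) : Heis n) := by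
    refine Prod.ext (funext fun i => ?_) ?_
    · simp [Prod.fst_sum, Finset.sum_apply, Pi.single_apply, Finset.sum_add_distrib]
    · simp [Prod.snd_sum]
  rw [contactForm_apply]
  conv_lhs => rw [h1]
  simp only [map_add, map_sum, map_smul, ev_Z, ev_bar_Z, Complex.real_smul]
  rw [add_mul, mul_assoc, Finset.sum_mul, Finset.mul_sum, add_comm _ (∑ i, _), ← add_assoc,
    ← Finset.sum_add_distrib]
  congr 1
  refine Finset.sum_congr rfl fun γ _ => ?_
  have h3 : conj (v.1 γ) = (v.1 γ).re - (v.1 γ).im * Complex.I := by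
    apply Complex.ext <;> simp
  have h4 : v.1 γ = (v.1 γ).re + (v.1 γ).im * Complex.I := (Complex.re_add_im _).symm
  have h5 := Complex.I_sq
  generalize conj (v.1 γ) = w at *
  generalize hx : ((v.1 γ).re : ℂ) = x at *
  generalize hy : ((v.1 γ).im : ℂ) = y at *
  rw [h3, h4]
  linear_combination (y * η (Pi.single γ Complex.I, 0)) * h5

/-- The `∂/∂t` coefficient `i z̄_α` of `Z_α` varies with the point, and differentiating it produces
the last term. -/
theorem fderiv_ev_Z {η : Form n} {p : Heis n} (hη : DifferentiableAt ℝ η p) (α : Fin n)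
    (v : Heis n) :
    fderiv ℝ (fun q => ev (η q) (Z α q)) p v =
      ev (fderiv ℝ η p v) (Z α p) + Complex.I * conj (v.1 α) * η p (0, 1) := by
  have e : (fun q => ev (η q) (Z α q)) = fun q =>
      (η q (Pi.single α 1, 0) - Complex.I * η q (Pi.single α Complex.I, 0)) / 2 +
      Complex.I * conj (q.1 α) * η q (0, 1) := by
    funext q; exact ev_Z _ _ _
  have h0 : ∀ w, HasFDerivAt (fun q => η q w) ((fderiv ℝ η p).flip w) p := fun w => by
    simpa using hη.hasFDerivAt.clm_apply (hasFDerivAt_const w p)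
  have h1 : HasFDerivAt (fun q : Heis n => conj (q.1 α)) (conjForm (dz n α)) p :=
    (conjForm (dz n α)).hasFDerivAt
  have h := (((h0 (Pi.single α 1, 0)).sub ((h0 (Pi.single α Complex.I, 0)).const_mul
    Complex.I)).mul_const (1 / 2 : ℂ)).add ((h1.const_mul Complex.I).mul (h0 (0, 1)))
  rw [e, ev_Z]
  have h' := h.fderiv
  simp only [Pi.sub_def, Pi.mul_def, Pi.add_def] at h'
  simp only [div_eq_mul_inv] at *
  simp only [one_mul] at h'
  rw [h']
  simp [conjForm, dz]
  ring

theorem fderiv_ev_bar_Z {η : Form n} {p : Heis n} (hη : DifferentiableAt ℝ η p) (α : Fin n)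
    (v : Heis n) :
    fderiv ℝ (fun q => ev (η q) (Z α q).bar) p v =
      ev (fderiv ℝ η p v) (Z α p).bar - Complex.I * v.1 α * η p (0, 1) := by
  have e : (fun q => ev (η q) (Z α q).bar) = fun q =>
      (η q (Pi.single α 1, 0) + Complex.I * η q (Pi.single α Complex.I, 0)) / 2 -
      Complex.I * q.1 α * η q (0, 1) := by
    funext q; exact ev_bar_Z _ _ _
  have h0 : ∀ w, HasFDerivAt (fun q => η q w) ((fderiv ℝ η p).flip w) p := fun w => by
    simpa using hη.hasFDerivAt.clm_apply (hasFDerivAt_const w p)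
  have h1 : HasFDerivAt (fun q : Heis n => q.1 α) (dz n α) p := (dz n α).hasFDerivAt
  have h := (((h0 (Pi.single α 1, 0)).add ((h0 (Pi.single α Complex.I, 0)).const_mul
    Complex.I)).mul_const (1 / 2 : ℂ)).sub ((h1.const_mul Complex.I).mul (h0 (0, 1)))
  rw [e, ev_bar_Z]
  have h' := h.fderiv
  simp only [Pi.sub_def, Pi.mul_def, Pi.add_def] at h'
  simp only [div_eq_mul_inv] at *
  simp only [one_mul] at h'
  rw [h']
  simp [dz]
  ring

theorem ev₂_fderiv_Z {η : Form n} {p : Heis n} (hη : DifferentiableAt ℝ η p) (α : Fin n)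
    (V : CVec n) :
    ev₂ (fun v w => fderiv ℝ η p v w) V (Z α p) =
      ev (fderiv ℝ (fun q => ev (η q) (Z α q)) p) V -
        Complex.I * ev (conjForm (dz n α)) V * η p (0, 1) := by
  rw [ev, fderiv_ev_Z hη, fderiv_ev_Z hη]
  simp only [ev, ev₂, conjForm, dz, ContinuousLinearMap.comp_apply]
  simp
  linear_combination (- fderiv ℝ η p V.2 (Z α p).2) * Complex.I_sq

theorem ev₂_fderiv_bar_Z {η : Form n} {p : Heis n} (hη : DifferentiableAt ℝ η p) (α : Fin n)
    (V : CVec n) :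
    ev₂ (fun v w => fderiv ℝ η p v w) V (Z α p).bar =
      ev (fderiv ℝ (fun q => ev (η q) (Z α q).bar) p) V +
        Complex.I * ev (dz n α) V * η p (0, 1) := by
  rw [ev, fderiv_ev_bar_Z hη, fderiv_ev_bar_Z hη]
  simp only [ev, ev₂, dz, ContinuousLinearMap.comp_apply]
  simp
  linear_combination (- fderiv ℝ η p V.2 (Z α p).bar.2) * Complex.I_sq

theorem ev₂_fderiv_Dt {η : Form n} {p : Heis n} (hη : DifferentiableAt ℝ η p) (V : CVec n) :
    ev₂ (fun v w => fderiv ℝ η p v w) V (Dt n) = ev (fderiv ℝ (fun q => η q (0, 1)) p) V := by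
  have h0 : HasFDerivAt (fun q => η q (0, 1)) ((fderiv ℝ η p).flip (0, 1)) p := by
    simpa using hη.hasFDerivAt.clm_apply (hasFDerivAt_const (0, 1) p)
  rw [h0.fderiv]
  simp [ev, ev₂, Dt]

theorem ev₂_d (η : Form n) (p : Heis n) (V W : CVec n) :
    ev₂ (d η p) V W = ev₂ (fun v w => fderiv ℝ η p v w) V W -
      ev₂ (fun v w => fderiv ℝ η p v w) W V := by
  simp only [ev₂, d]; ring

/-- Cartan's formula `dη(V,W) = V η(W) - W η(V) - η([V,W])` with `[Z_ρ, Z_σ̄] = -2i δ_{ρσ} ∂_t`. The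
analogues below have no last term because the corresponding brackets vanish. -/
theorem ev₂_d_Z_bar {η : Form n} {p : Heis n} (hη : DifferentiableAt ℝ η p) (ρ σ : Fin n) :
    ev₂ (d η p) (Z ρ p) (Z σ p).bar =
      deriv (Z ρ) (fun q => ev (η q) (Z σ q).bar) p -
      deriv (fun q => (Z σ q).bar) (fun q => ev (η q) (Z ρ q)) p +
      if ρ = σ then 2 * Complex.I * η p (0, 1) else 0 := by
  rw [ev₂_d, ev₂_fderiv_Z hη, ev₂_fderiv_bar_Z hη, ev_dz_Z, ev_conj_dz_bar_Z, deriv, deriv]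
  by_cases h : ρ = σ
  · simp [h]; ring
  · simp [h, Ne.symm h]

theorem ev₂_d_bar_bar {η : Form n} {p : Heis n} (hη : DifferentiableAt ℝ η p) (ρ σ : Fin n) :
    ev₂ (d η p) (Z ρ p).bar (Z σ p).bar =
      deriv (fun q => (Z ρ q).bar) (fun q => ev (η q) (Z σ q).bar) p -
      deriv (fun q => (Z σ q).bar) (fun q => ev (η q) (Z ρ q).bar) p := by
  rw [ev₂_d, ev₂_fderiv_bar_Z hη, ev₂_fderiv_bar_Z hη, ev_dz_bar_Z, ev_dz_bar_Z, deriv, deriv]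
  simp

theorem ev₂_d_Dt_Z {η : Form n} {p : Heis n} (hη : DifferentiableAt ℝ η p) (σ : Fin n) :
    ev₂ (d η p) (Dt n) (Z σ p) =
      fderiv ℝ (fun q => ev (η q) (Z σ q)) p (0, 1) -
      deriv (Z σ) (fun q => η q (0, 1)) p := by
  rw [ev₂_d, ev₂_fderiv_Z hη, ev₂_fderiv_Dt hη, ev_conj_dz_Dt, ev_Dt, deriv]
  simp

theorem ev₂_d_Dt_bar {η : Form n} {p : Heis n} (hη : DifferentiableAt ℝ η p) (σ : Fin n) :
    ev₂ (d η p) (Dt n) (Z σ p).bar =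
      fderiv ℝ (fun q => ev (η q) (Z σ q).bar) p (0, 1) -
      deriv (fun q => (Z σ q).bar) (fun q => η q (0, 1)) p := by
  rw [ev₂_d, ev₂_fderiv_bar_Z hη, ev₂_fderiv_Dt hη, ev_dz_Dt, ev_Dt, deriv]
  simp

theorem deriv_mul' (V : Heis n → CVec n) {φ ψ : Heis n → ℂ} {p : Heis n}
    (hφ : DifferentiableAt ℝ φ p) (hψ : DifferentiableAt ℝ ψ p) :
    deriv V (fun q => φ q * ψ q) p = φ p * deriv V ψ p + deriv V φ p * ψ p := by
  rw [deriv, fderiv_fun_mul hφ hψ]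
  simp [deriv, ev]
  ring

theorem deriv_const (V : Heis n → CVec n) (c : ℂ) (p : Heis n) :
    deriv V (fun _ => c) p = 0 := by
  simp [deriv, ev]

theorem deriv_const_mul (V : Heis n → CVec n) {φ : Heis n → ℂ} {p : Heis n} (c : ℂ)
    (hφ : DifferentiableAt ℝ φ p) :
    deriv V (fun q => c * φ q) p = c * deriv V φ p := by
  rw [deriv_mul' V (differentiableAt_const c) hφ, deriv_const]
  simp

theorem deriv_add (V : Heis n → CVec n) {φ ψ : Heis n → ℂ} {p : Heis n}
    (hφ : DifferentiableAt ℝ φ p) (hψ : DifferentiableAt ℝ ψ p) :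
    deriv V (fun q => φ q + ψ q) p = deriv V φ p + deriv V ψ p := by
  rw [deriv, fderiv_fun_add hφ hψ]
  simp [deriv, ev]
  ring

theorem deriv_coord (V : Heis n → CVec n) (β : Fin n) (p : Heis n) :
    deriv V (fun q => q.1 β) p = ev (dz n β) (V p) := by
  rw [deriv, show fderiv ℝ (fun q : Heis n => q.1 β) p = dz n β from (dz n β).hasFDerivAt.fderiv]

theorem deriv_conj_coord (V : Heis n → CVec n) (β : Fin n) (p : Heis n) :
    deriv V (fun q => conj (q.1 β)) p = ev (conjForm (dz n β)) (V p) := by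
  rw [deriv, show fderiv ℝ (fun q : Heis n => conj (q.1 β)) p = conjForm (dz n β) from
    (conjForm (dz n β)).hasFDerivAt.fderiv]

theorem hasFDerivAt_comp_time {k : ℝ → ℝ} {k' : ℝ} {p : Heis n} (hk : HasDerivAt k k' p.2) :
    HasFDerivAt (fun q : Heis n => (k q.2 : ℂ))
      (toC (k' • ContinuousLinearMap.snd ℝ (Fin n → ℂ) ℝ)) p := by
  have h := hk.comp_hasFDerivAt p (hasFDerivAt_snd (𝕜 := ℝ) (E := Fin n → ℂ) (F := ℝ))
  exact Complex.ofRealCLM.hasFDerivAt.comp p h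

theorem deriv_time_Z {k : ℝ → ℝ} {k' : ℝ} {p : Heis n} (hk : HasDerivAt k k' p.2) (α : Fin n) :
    deriv (Z α) (fun q => (k q.2 : ℂ)) p = Complex.I * conj (p.1 α) * k' := by
  rw [deriv, (hasFDerivAt_comp_time hk).fderiv, ev_Z]
  simp [toC]

theorem deriv_time_bar_Z {k : ℝ → ℝ} {k' : ℝ} {p : Heis n} (hk : HasDerivAt k k' p.2)
    (α : Fin n) :
    deriv (fun q => (Z α q).bar) (fun q => (k q.2 : ℂ)) p = -(Complex.I * p.1 α * k') := by
  rw [deriv, (hasFDerivAt_comp_time hk).fderiv, ev_bar_Z]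
  simp [toC]

end HeisenbergCR

/-! ### Pseudohermitian geometry of `e^{2v(t)} θ₀` and the soliton equations as explicit PDEs. -/

namespace HeisenbergCR

variable {n : ℕ}

/-- The contact form `e^{2v(t)} θ₀`. -/
noncomputable def confForm (n : ℕ) (v : ℝ → ℝ) (p : Heis n) : Heis n →L[ℝ] ℝ :=
  Real.exp (2 * v p.2) • contactForm n p

theorem toC_smul (c : ℝ) (η : Heis n →L[ℝ] ℝ) (w : Heis n) : toC (c • η) w = c * toC η w := by
  simp [toC]

theorem ev_toC_bar (η : Heis n →L[ℝ] ℝ) (V : CVec n) :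
    ev (toC η) V.bar = conj (ev (toC η) V) := by
  simp [ev, toC, CVec.bar]

theorem ev_confForm_Z (v : ℝ → ℝ) (α : Fin n) (p : Heis n) :
    ev (toC (confForm n v p)) (Z α p) = 0 := by
  have h := ev_contactForm_Z α p
  rw [ev] at h ⊢
  rw [confForm, toC_smul, toC_smul]
  linear_combination (Real.exp (2 * v p.2) : ℂ) * h

theorem ev_confForm_bar_Z (v : ℝ → ℝ) (α : Fin n) (p : Heis n) :
    ev (toC (confForm n v p)) (Z α p).bar = 0 := by
  rw [ev_toC_bar, ev_confForm_Z, map_zero]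

theorem toC_contactForm_Dt (p : Heis n) : toC (contactForm n p) (0, 1) = 1 := by
  have h : toC (contactForm n p) (0, 1) = _ := contactForm_apply p (0, 1)
  rw [h]
  simp

theorem confForm_Dt (v : ℝ → ℝ) (p : Heis n) :
    toC (confForm n v p) (0, 1) = (Real.exp (2 * v p.2) : ℂ) := by
  rw [confForm, toC_smul, toC_contactForm_Dt, mul_one]

theorem ev₂_congr {b c : Heis n → Heis n → ℂ} (h : ∀ v w, b v w = c v w) (V W : CVec n) :
    ev₂ b V W = ev₂ c V W := by
  simp only [ev₂, h]

theorem ev₂_sum {ι : Type*} (s : Finset ι) (b : ι → Heis n → Heis n → ℂ) (V W : CVec n) :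
    ev₂ (fun v w => ∑ i ∈ s, b i v w) V W = ∑ i ∈ s, ev₂ (b i) V W := by
  simp only [ev₂, Finset.mul_sum, ← Finset.sum_add_distrib, ← Finset.sum_sub_distrib]

theorem ev₂_add (b c : Heis n → Heis n → ℂ) (V W : CVec n) :
    ev₂ (fun v w => b v w + c v w) V W = ev₂ b V W + ev₂ c V W := by
  simp only [ev₂]; ring

theorem ev₂_sub (b c : Heis n → Heis n → ℂ) (V W : CVec n) :
    ev₂ (fun v w => b v w - c v w) V W = ev₂ b V W - ev₂ c V W := by
  simp only [ev₂]; ring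

theorem hasDerivAt_exp_two {v : ℝ → ℝ} {a t : ℝ} (h : HasDerivAt v a t) :
    HasDerivAt (fun s => Real.exp (2 * v s)) (2 * a * Real.exp (2 * v t)) t := by
  have := (h.const_mul 2).exp
  rwa [mul_comm] at this

section Conformal

variable {v v' v'' : ℝ → ℝ}

theorem differentiableAt_toC {θ : Heis n → Heis n →L[ℝ] ℝ} (h : IsPseudohermitian θ) (p : Heis n) :
    DifferentiableAt ℝ (fun q => toC (θ q)) p := by
  have h1 : ContDiff ℝ ∞ (fun q => toC (θ q)) := contDiff_const.clm_comp h.smooth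
  exact h1.differentiable (by simp) p

theorem levi_confForm (hps : IsPseudohermitian (confForm n v)) (p : Heis n) (α β : Fin n) :
    levi (confForm n v) p α β = if α = β then 2 * (Real.exp (2 * v p.2) : ℂ) else 0 := by
  rw [levi, ev₂_d_Z_bar (differentiableAt_toC hps p)]
  simp only [ev_confForm_Z, ev_confForm_bar_Z, deriv_const, confForm_Dt]
  split_ifs
  · linear_combination (-2 * (Real.exp (2 * v p.2) : ℂ)) * Complex.I_sq
  · simp

theorem inv_levi_confForm (hps : IsPseudohermitian (confForm n v)) (p : Heis n) :
    (levi (confForm n v) p)⁻¹ =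
      Matrix.diagonal fun _ => (2 * (Real.exp (2 * v p.2) : ℂ))⁻¹ := by
  have h : levi (confForm n v) p = Matrix.diagonal fun _ => 2 * (Real.exp (2 * v p.2) : ℂ) := by
    ext α β
    rw [levi_confForm hps, Matrix.diagonal_apply]
  have h0 : (2 * (Real.exp (2 * v p.2) : ℂ)) ≠ 0 := by
    simp
  rw [h]
  apply Matrix.inv_eq_right_inv
  rw [Matrix.diagonal_mul_diagonal, mul_inv_cancel₀ h0, Matrix.diagonal_one]

theorem lower_confForm (hps : IsPseudohermitian (confForm n v)) (τ : Fin n → Form n) (α : Fin n)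
    (p : Heis n) (V : CVec n) : ev (lower (confForm n v) τ α p) V =
      2 * (Real.exp (2 * v p.2) : ℂ) * conj (ev (τ α p) V.bar) := by
  rw [lower]
  simp only [levi_confForm hps]
  rw [Finset.sum_eq_single α (fun b _ hb => by rw [if_neg (Ne.symm hb)]; exact zero_smul ℂ (conjForm (τ b p))) (by simp),
    ← ev_conjForm]
  simp [ev]
  ring

/-- The characteristic direction of `e^{2v(t)} θ₀`. -/
theorem characteristic_eq (hv : ∀ t, HasDerivAt v (v' t) t)
    (hps : IsPseudohermitian (confForm n v)) {T : Heis n → Heis n}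
    {ϑ : Fin n → Form n} (hco : IsAdmissibleCoframe (confForm n v) T ϑ) (p : Heis n) :
    T p = Real.exp (-(2 * v p.2)) • (-(v' p.2) • p.1, 1) := by
  have hE : Real.exp (-(2 * v p.2)) * Real.exp (2 * v p.2) = 1 := by
    rw [← Real.exp_add]; simp
  have hEC : (Real.exp (-(2 * v p.2)) : ℂ) * (Real.exp (2 * v p.2) : ℂ) = 1 := by
    exact_mod_cast hE
  have h1 : contactForm n p (T p) = Real.exp (-(2 * v p.2)) := by
    have := hco.theta_T p
    simp only [confForm, smul_apply, smul_eq_mul] at this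
    have h0 := Real.exp_pos (2 * v p.2)
    apply mul_left_cancel₀ h0.ne'
    rw [this, mul_comm, hE]
  have hd := differentiableAt_toC hps p
  have h2 : ∀ β, (T p).1 β = -(Real.exp (-(2 * v p.2)) * v' p.2) * p.1 β := by
    intro β
    -- The covector `dθ(·, Z_β̄)`. It annihilates `T`, and expanding `η (T p)` in the coframe leaves
    -- only the `dz_β` component of `T` and its known `θ₀` component.
    let η : Heis n →L[ℝ] ℂ :=
      (fderiv ℝ (fun q => toC (confForm n v q)) p).flip (Z β p).bar.1 -
        fderiv ℝ (fun q => toC (confForm n v q)) p (Z β p).bar.1 + Complex.I •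
      ((fderiv ℝ (fun q => toC (confForm n v q)) p).flip (Z β p).bar.2 -
        fderiv ℝ (fun q => toC (confForm n v q)) p (Z β p).bar.2)
    have hη : ∀ w, η w = d (fun q => toC (confForm n v q)) p w (Z β p).bar.1 +
        Complex.I * d (fun q => toC (confForm n v q)) p w (Z β p).bar.2 := fun w => by
      simp [η, d]
    have hev : ∀ V, ev η V = ev₂ (d (fun q => toC (confForm n v q)) p) V (Z β p).bar := fun V => by
      rw [ev, hη, hη, ev₂]
      linear_combination (d (fun q => toC (confForm n v q)) p V.2 (Z β p).bar.2) * Complex.I_sq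
    have h3 : η (T p) = 0 := by
      rw [hη, hco.dtheta_T, hco.dtheta_T]; simp
    rw [form_apply_eq η p, h1, ← ev_Dt η] at h3
    simp only [hev] at h3
    rw [ev₂_d_Dt_bar hd] at h3
    simp only [ev₂_d_Z_bar hd, ev₂_d_bar_bar hd, ev_confForm_Z, ev_confForm_bar_Z, deriv_const,
      confForm_Dt] at h3
    rw [deriv_time_bar_Z (hasDerivAt_exp_two (hv p.2)),
      Finset.sum_eq_single β (fun b _ hb => by simp [hb]) (by simp)] at h3
    simp only [if_true] at h3
    have hI := Complex.I_sq
    simp at h3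
    push_cast at *
    generalize Complex.exp (-(2 * (v p.2 : ℂ))) = e' at *
    generalize Complex.exp (2 * (v p.2 : ℂ)) = e at *
    linear_combination (-Complex.I * e' / 2) * h3 +
      ((T p).1 β * e' * e + e' * e' * e * v' p.2 * p.1 β) * hI
      - ((T p).1 β + e' * v' p.2 * p.1 β) * hEC
  have h3 : (T p).2 = Real.exp (-(2 * v p.2)) := by
    have h4 := contactForm_apply p (T p)
    rw [h1, Finset.sum_eq_zero, mul_zero, add_zero] at h4
    · exact_mod_cast h4.symm
    · intro i _
      rw [h2]
      simp only [map_mul, map_neg, Complex.conj_ofReal]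
      ring
  refine Prod.ext (funext fun β => ?_) ?_
  · rw [h2]; simp; ring
  · simp [h3]

/-- Solving `θ^α(T) = 0` for the one value of `θ^α` not fixed by duality; in other words `θ^α = dz_α
+ v' z_α θ₀`. -/
theorem coframe_Dt (hv : ∀ t, HasDerivAt v (v' t) t)
    (hps : IsPseudohermitian (confForm n v)) {T : Heis n → Heis n}
    {ϑ : Fin n → Form n} (hco : IsAdmissibleCoframe (confForm n v) T ϑ) (p : Heis n) (α : Fin n) :
    ϑ α p (0, 1) = p.1 α * v' p.2 := by
  have h := hco.coframe_T α p
  rw [characteristic_eq hv hps hco p, map_smul, smul_eq_zero_iff_right (Real.exp_pos _).ne',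
    form_apply_eq (ϑ α p) p] at h
  have h1 : (contactForm n p (-(v' p.2) • p.1, 1) : ℂ) = 1 := by
    rw [contactForm_apply, Finset.sum_eq_zero]
    · simp
    · intro i _
      simp
      ring
  rw [h1] at h
  simp only [hco.coframe_Z, hco.coframe_Zbar] at h
  simp at h
  linear_combination h

variable {T : Heis n → Heis n} {ϑ : Fin n → Form n} {Γ : Fin n → Fin n → Form n}
  {τ : Fin n → Form n}

theorem structure_ev₂ {θ : Heis n → Heis n →L[ℝ] ℝ} (htw : IsTanakaWebster θ ϑ Γ τ)
    (α : Fin n) (p : Heis n) (V W : CVec n) :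
    ev₂ (d (ϑ α) p) V W =
      ∑ β, (ev (ϑ β p) V * ev (Γ β α p) W - ev (ϑ β p) W * ev (Γ β α p) V) +
      (ev (toC (θ p)) V * ev (τ α p) W - ev (toC (θ p)) W * ev (τ α p) V) := by
  rw [ev₂_congr (htw.structure_eq α p), ev₂_add, ev₂_sum]
  simp only [ev₂_wedge]

theorem differentiableAt_of_contDiff {F : Type*} [NormedAddCommGroup F] [NormedSpace ℝ F]
    {φ : Heis n → F} (h : ContDiff ℝ ∞ φ) (p : Heis n) : DifferentiableAt ℝ φ p :=
  h.differentiable (by simp) p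

theorem differentiableAt_time {k : ℝ → ℝ} {k' : ℝ} {p : Heis n} (hk : HasDerivAt k k' p.2) :
    DifferentiableAt ℝ (fun q : Heis n => (k q.2 : ℂ)) p :=
  (hasFDerivAt_comp_time hk).differentiableAt

theorem deriv_coord_mul_time_Z {k : ℝ → ℝ} {k' : ℝ} {p : Heis n} (hk : HasDerivAt k k' p.2)
    (σ α : Fin n) : deriv (Z σ) (fun q => q.1 α * (k q.2 : ℂ)) p =
      p.1 α * (Complex.I * conj (p.1 σ) * k') + (if α = σ then 1 else 0) * k p.2 := by
  rw [deriv_mul' _ (by fun_prop) (differentiableAt_time hk), deriv_time_Z hk, deriv_coord, ev_dz_Z]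

theorem deriv_coord_mul_time_bar_Z {k : ℝ → ℝ} {k' : ℝ} {p : Heis n} (hk : HasDerivAt k k' p.2)
    (σ α : Fin n) : deriv (fun q => (Z σ q).bar) (fun q => q.1 α * (k q.2 : ℂ)) p =
      -(p.1 α * (Complex.I * p.1 σ * k')) := by
  rw [deriv_mul' _ (by fun_prop) (differentiableAt_time hk), deriv_time_bar_Z hk, deriv_coord,
    ev_dz_bar_Z]
  ring

theorem differentiable_conj_coord (α : Fin n) (p : Heis n) :
    DifferentiableAt ℝ (fun q : Heis n => conj (q.1 α)) p :=
  (conjForm (dz n α)).differentiableAt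

theorem deriv_conj_mul_time_Z {k : ℝ → ℝ} {k' : ℝ} {p : Heis n} (hk : HasDerivAt k k' p.2)
    (σ α : Fin n) : deriv (Z σ) (fun q => conj (q.1 α) * (k q.2 : ℂ)) p =
      conj (p.1 α) * (Complex.I * conj (p.1 σ) * k') := by
  rw [deriv_mul' _ (differentiable_conj_coord α p) (differentiableAt_time hk), deriv_time_Z hk,
    deriv_conj_coord, ev_conj_dz_Z]
  ring

theorem deriv_conj_mul_time_bar_Z {k : ℝ → ℝ} {k' : ℝ} {p : Heis n} (hk : HasDerivAt k k' p.2)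
    (σ α : Fin n) : deriv (fun q => (Z σ q).bar) (fun q => conj (q.1 α) * (k q.2 : ℂ)) p =
      -(conj (p.1 α) * (Complex.I * p.1 σ * k')) + (if α = σ then 1 else 0) * k p.2 := by
  rw [deriv_mul' _ (differentiable_conj_coord α p) (differentiableAt_time hk),
    deriv_time_bar_Z hk, deriv_conj_coord, ev_conj_dz_bar_Z]
  ring

/-- On the pair `(Z_ρ, Z_σ̄)` the structure equation has constant coframe values and no torsion
contribution, so only the bracket term `2i θ^α(∂_t)` remains on the left. -/
theorem connection_bar_Z (hv : ∀ t, HasDerivAt v (v' t) t)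
    (hps : IsPseudohermitian (confForm n v))
    (hco : IsAdmissibleCoframe (confForm n v) T ϑ) (htw : IsTanakaWebster (confForm n v) ϑ Γ τ)
    (ρ α σ : Fin n) (p : Heis n) :
    ev (Γ ρ α p) (Z σ p).bar = if ρ = σ then 2 * Complex.I * (p.1 α * v' p.2) else 0 := by
  have h := structure_ev₂ htw α p (Z ρ p) (Z σ p).bar
  rw [ev₂_d_Z_bar (differentiableAt_of_contDiff (hco.smooth α) p)] at h
  simp only [hco.coframe_Z, hco.coframe_Zbar, deriv_const, ev_confForm_Z, ev_confForm_bar_Z,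
    coframe_Dt hv hps hco] at h
  simp at h
  exact h.symm

/-- Compatibility with the Levi form, which is `2e^{2v}` times the identity, trades `ω(Z)` for the
conjugate of `ω(Z̄)`, already known from `connection_bar_Z`. -/
theorem connection_Z (hv : ∀ t, HasDerivAt v (v' t) t)
    (hps : IsPseudohermitian (confForm n v))
    (hco : IsAdmissibleCoframe (confForm n v) T ϑ) (htw : IsTanakaWebster (confForm n v) ϑ Γ τ)
    (α σ β : Fin n) (p : Heis n) :
    ev (Γ α σ p) (Z β p) = (if α = σ then 2 * Complex.I * (conj (p.1 β) * v' p.2) else 0) +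
      if σ = β then 2 * Complex.I * (conj (p.1 α) * v' p.2) else 0 := by
  have h1 : ∀ w, fderiv ℝ (fun q => levi (confForm n v) q α σ) p w =
      2 * (Real.exp (2 * v p.2) : ℂ) * (conj (Γ σ α p w) + Γ α σ p w) := by
    intro w
    rw [htw.metric_eq]
    simp only [levi_confForm hps]
    rw [Finset.sum_eq_single α (fun b _ hb => by simp [Ne.symm hb]) (by simp),
      Finset.sum_eq_single σ (fun b _ hb => by simp [hb]) (by simp)]
    simp
    ring
  have h2 : deriv (Z β) (fun q => levi (confForm n v) q α σ) p =
      2 * (Real.exp (2 * v p.2) : ℂ) * (conj (ev (Γ σ α p) (Z β p).bar) +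
        ev (Γ α σ p) (Z β p)) := by
    rw [deriv, ev, h1, h1]
    simp [ev, CVec.bar]
    ring
  simp only [levi_confForm hps] at h2
  rw [connection_bar_Z hv hps hco htw] at h2
  have h3 : deriv (Z β)
      (fun q => if α = σ then 2 * (Real.exp (2 * v q.2) : ℂ) else 0) p =
      2 * (Real.exp (2 * v p.2) : ℂ) *
        if α = σ then 2 * Complex.I * (conj (p.1 β) * v' p.2) else 0 := by
    split_ifs
    · rw [deriv_const_mul _ _ (differentiableAt_time (hasDerivAt_exp_two (hv p.2))),
        deriv_time_Z (hasDerivAt_exp_two (hv p.2))]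
      push_cast
      ring
    · simp [deriv_const]
  rw [h3] at h2
  have h4 := mul_left_cancel₀ (by simp) h2
  rw [h4]
  by_cases h : σ = β
  · simp [h, Complex.conj_ofNat]
  · simp [h]

/-- Evaluating `τ_β ∧ θ^β = 0` on `(Z_σ̄, Z_α)` isolates `τ_α(Z_σ̄)`, a nonzero multiple of the
conjugate of `τ^α(Z_σ)`. -/
theorem torsionForm_Z (hps : IsPseudohermitian (confForm n v))
    (hco : IsAdmissibleCoframe (confForm n v) T ϑ) (htw : IsTanakaWebster (confForm n v) ϑ Γ τ)
    (α σ : Fin n) (p : Heis n) : ev (τ α p) (Z σ p) = 0 := by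
  have h : ev₂ (fun w x => ∑ β, wedge (lower (confForm n v) τ β p) (ϑ β p) w x)
      (Z σ p).bar (Z α p) = 0 := by
    rw [ev₂_congr (c := fun _ _ => 0) (htw.torsion_eq p)]
    simp [ev₂]
  rw [ev₂_sum] at h
  simp only [ev₂_wedge, hco.coframe_Z, hco.coframe_Zbar, lower_confForm hps, bar_bar] at h
  simp at h
  exact h

/-- The structure equation on `(∂_t, Z_α)`, where `torsionForm_Z` removes the torsion. Diagonal
entries suffice, because the Ricci form only sees the trace of the connection. -/
theorem connection_Dt (hv : ∀ t, HasDerivAt v (v' t) t) (hv' : ∀ t, HasDerivAt v' (v'' t) t)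
    (hps : IsPseudohermitian (confForm n v))
    (hco : IsAdmissibleCoframe (confForm n v) T ϑ) (htw : IsTanakaWebster (confForm n v) ϑ Γ τ)
    (α : Fin n) (p : Heis n) :
    Γ α α p (0, 1) = v' p.2 + p.1 α * conj (p.1 α) *
      (Complex.I * v'' p.2 + 2 * Complex.I * (v' p.2) ^ 2) +
      2 * Complex.I * (v' p.2) ^ 2 * ∑ β, p.1 β * conj (p.1 β) := by
  have h := structure_ev₂ htw α p (Dt n) (Z α p)
  rw [ev₂_d_Dt_Z (differentiableAt_of_contDiff (hco.smooth α) p)] at h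
  simp only [hco.coframe_Z, torsionForm_Z hps hco htw, ev_confForm_Z, ev_Dt,
    coframe_Dt hv hps hco, deriv_coord_mul_time_Z (hv' p.2),
    connection_Z hv hps hco htw] at h
  simp [mul_add, Finset.sum_add_distrib] at h
  rw [Finset.sum_congr rfl (g := fun x => 2 * Complex.I * (v' p.2) ^ 2 * (p.1 x * conj (p.1 x)))
    (fun x _ => by ring), ← Finset.mul_sum] at h
  linear_combination h

/-- The structure equation on `(∂_t, Z_ᾱ)`, with the connection values already found. -/
theorem torsionForm_bar_Z (hv : ∀ t, HasDerivAt v (v' t) t) (hv' : ∀ t, HasDerivAt v' (v'' t) t)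
    (hps : IsPseudohermitian (confForm n v))
    (hco : IsAdmissibleCoframe (confForm n v) T ϑ) (htw : IsTanakaWebster (confForm n v) ϑ Γ τ)
    (α : Fin n) (p : Heis n) :
    (Real.exp (2 * v p.2) : ℂ) * ev (τ α p) (Z α p).bar =
      Complex.I * (p.1 α) ^ 2 * (v'' p.2 - 2 * (v' p.2) ^ 2) := by
  have h := structure_ev₂ htw α p (Dt n) (Z α p).bar
  rw [ev₂_d_Dt_bar (differentiableAt_of_contDiff (hco.smooth α) p)] at h
  simp only [hco.coframe_Zbar, ev_confForm_bar_Z, ev_Dt, confForm_Dt,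
    coframe_Dt hv hps hco, deriv_coord_mul_time_bar_Z (hv' p.2),
    connection_bar_Z hv hps hco htw] at h
  simp at h
  push_cast
  linear_combination -h

theorem torsion_confForm (hv : ∀ t, HasDerivAt v (v' t) t) (hv' : ∀ t, HasDerivAt v' (v'' t) t)
    (hps : IsPseudohermitian (confForm n v))
    (hco : IsAdmissibleCoframe (confForm n v) T ϑ) (htw : IsTanakaWebster (confForm n v) ϑ Γ τ)
    (α : Fin n) (p : Heis n) :
    torsion (confForm n v) τ α α p =
      -2 * Complex.I * (conj (p.1 α)) ^ 2 * (v'' p.2 - 2 * (v' p.2) ^ 2) := by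
  have h := congrArg conj (torsionForm_bar_Z hv hv' hps hco htw α p)
  rw [torsion, lower_confForm hps]
  rw [map_mul, Complex.conj_ofReal] at h
  rw [mul_assoc, h]
  simp [Complex.conj_ofNat]
  ring

theorem hess_confForm (hv : ∀ t, HasDerivAt v (v' t) t)
    (hps : IsPseudohermitian (confForm n v))
    (hco : IsAdmissibleCoframe (confForm n v) T ϑ) (htw : IsTanakaWebster (confForm n v) ϑ Γ τ)
    (f : Heis n → ℝ) (α : Fin n) (p : Heis n) :
    hess Γ f α α p = deriv (Z α) (deriv (Z α) (fun q => (f q : ℂ))) p -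
      4 * Complex.I * conj (p.1 α) * v' p.2 * deriv (Z α) (fun q => (f q : ℂ)) p := by
  rw [hess]
  simp only [connection_Z hv hps hco htw]
  rw [Finset.sum_eq_single α (fun b _ hb => by simp [hb, Ne.symm hb]) (by simp)]
  simp only [if_true]
  ring

theorem ev₂_d_connection (hv : ∀ t, HasDerivAt v (v' t) t) (hv' : ∀ t, HasDerivAt v' (v'' t) t)
    (hps : IsPseudohermitian (confForm n v))
    (hco : IsAdmissibleCoframe (confForm n v) T ϑ) (htw : IsTanakaWebster (confForm n v) ϑ Γ τ)
    (α ρ : Fin n) (p : Heis n) :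
    ev₂ (d (Γ α α) p) (Z ρ p) (Z ρ p).bar =
      (if α = ρ then -4 * (p.1 ρ * conj (p.1 ρ)) * v'' p.2 else 0) -
      2 * (p.1 ρ * conj (p.1 ρ)) * v'' p.2 -
      (p.1 α * conj (p.1 α)) * (4 * (v' p.2) ^ 2 + 2 * v'' p.2) -
      4 * (v' p.2) ^ 2 * ∑ β, p.1 β * conj (p.1 β) := by
  rw [ev₂_d_Z_bar (differentiableAt_of_contDiff (htw.smooth_connection α α) p)]
  simp only [connection_Z hv hps hco htw, connection_bar_Z hv hps hco htw,
    connection_Dt hv hv' hps hco htw, if_true]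
  have hdz : DifferentiableAt ℝ (fun q : Heis n => q.1 α * (v' q.2 : ℂ)) p :=
    DifferentiableAt.mul (by fun_prop) (differentiableAt_time (hv' p.2))
  have hdc : ∀ β, DifferentiableAt ℝ (fun q : Heis n => conj (q.1 β) * (v' q.2 : ℂ)) p := fun β =>
    (differentiable_conj_coord β p).mul (differentiableAt_time (hv' p.2))
  by_cases h : α = ρ
  · subst h
    simp only [if_true]
    rw [deriv_const_mul _ _ hdz, deriv_add _ ((hdc α).const_mul _) ((hdc α).const_mul _),
      deriv_const_mul _ _ (hdc α), deriv_coord_mul_time_Z (hv' p.2),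
      deriv_conj_mul_time_bar_Z (hv' p.2)]
    simp only [if_true]
    linear_combination (8 * (p.1 α * conj (p.1 α)) * v'' p.2 +
      4 * (p.1 α * conj (p.1 α)) * (v' p.2) ^ 2 +
      4 * (v' p.2) ^ 2 * ∑ β, p.1 β * conj (p.1 β)) * Complex.I_sq
  · simp only [h, if_false, deriv_const, add_zero]
    rw [deriv_const_mul _ _ (hdc ρ), deriv_conj_mul_time_bar_Z (hv' p.2)]
    simp only [if_true]
    linear_combination (2 * (p.1 ρ * conj (p.1 ρ)) * v'' p.2 +
      2 * (p.1 α * conj (p.1 α)) * v'' p.2 +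
      4 * (p.1 α * conj (p.1 α)) * (v' p.2) ^ 2 +
      4 * (v' p.2) ^ 2 * ∑ β, p.1 β * conj (p.1 β)) * Complex.I_sq

/-- The quadratic part `ω_α^γ ∧ ω_γ^α` is antisymmetric under exchanging `α` and `γ`, so it vanishes
in the trace. -/
theorem ricci_eq_sum (Γ : Fin n → Fin n → Form n) (ρ σ : Fin n) (p : Heis n) :
    ricci Γ p ρ σ = ∑ α, ev₂ (d (Γ α α) p) (Z ρ p) (Z σ p).bar := by
  have h : ∀ α, curvature Γ α α ρ σ p = ev₂ (d (Γ α α) p) (Z ρ p) (Z σ p).bar -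
      ∑ γ, (ev (Γ α γ p) (Z ρ p) * ev (Γ γ α p) (Z σ p).bar -
        ev (Γ α γ p) (Z σ p).bar * ev (Γ γ α p) (Z ρ p)) := by
    intro α
    have h1 : curvForm Γ α α p = fun v w => d (Γ α α) p v w -
        ∑ γ, wedge (Γ α γ p) (Γ γ α p) v w := rfl
    rw [curvature, h1, ev₂_sub, ev₂_sum]
    simp only [ev₂_wedge]
  rw [ricci, Finset.sum_congr rfl (fun α _ => h α), Finset.sum_sub_distrib]
  simp only [Finset.sum_sub_distrib]
  rw [Finset.sum_comm (f := fun α γ => ev (Γ α γ p) (Z ρ p) * ev (Γ γ α p) (Z σ p).bar)]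
  simp only [mul_comm, sub_self, sub_zero]

theorem scalarCurvature_confForm (hv : ∀ t, HasDerivAt v (v' t) t)
    (hv' : ∀ t, HasDerivAt v' (v'' t) t) (hps : IsPseudohermitian (confForm n v))
    (hco : IsAdmissibleCoframe (confForm n v) T ϑ) (htw : IsTanakaWebster (confForm n v) ϑ Γ τ)
    (p : Heis n) :
    scalarCurvature (confForm n v) Γ p = -2 * (n + 1) * (Real.exp (-(2 * v p.2)) : ℂ) *
      (v'' p.2 + n * (v' p.2) ^ 2) * ∑ β, p.1 β * conj (p.1 β) := by
  rw [scalarCurvature, inv_levi_confForm hps]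
  have h1 : ∀ ρ, ∑ σ, (Matrix.diagonal fun _ : Fin n => (2 * (Real.exp (2 * v p.2) : ℂ))⁻¹) σ ρ *
      ricci Γ p ρ σ = (2 * (Real.exp (2 * v p.2) : ℂ))⁻¹ * ricci Γ p ρ ρ := by
    intro ρ
    rw [Finset.sum_eq_single ρ (fun b _ hb => by simp [hb]) (by simp)]
    simp
  rw [Finset.sum_congr rfl (fun ρ _ => h1 ρ), ← Finset.mul_sum]
  simp only [ricci_eq_sum, ev₂_d_connection hv hv' hps hco htw]
  simp only [Finset.sum_sub_distrib, Finset.sum_ite_eq', Finset.mem_univ, if_true,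
    Finset.sum_const, Finset.card_univ, Fintype.card_fin, nsmul_eq_mul, ← Finset.mul_sum,
    ← Finset.sum_mul]
  rw [Real.exp_neg]
  push_cast
  have h0 : Complex.exp (2 * (v p.2 : ℂ)) ≠ 0 := Complex.exp_ne_zero _
  field_simp
  ring

theorem IsCRYamabeSoliton.characteristic_pde {f : Heis n → ℝ} {μ : ℝ}
    (hv : ∀ t, HasDerivAt v (v' t) t) (hv' : ∀ t, HasDerivAt v' (v'' t) t)
    (h : IsCRYamabeSoliton (confForm n v) f μ) (p : Heis n) :
    fderiv ℝ f p (-(v' p.2) • p.1, 1) = 2 * μ * Real.exp (2 * v p.2) +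
      4 * (n + 1) * (v'' p.2 + n * (v' p.2) ^ 2) * ∑ β, Complex.normSq (p.1 β) := by
  obtain ⟨hps, -, T, ϑ, Γ, τ, hco, htw, h1, -⟩ := h
  have h2 := h1 p
  rw [scalarCurvature_confForm hv hv' hps hco htw, characteristic_eq hv hps hco, map_smul] at h2
  simp only [Complex.mul_conj] at h2
  norm_cast at h2
  rw [Real.exp_neg] at h2
  have h0 : Real.exp (2 * v p.2) ≠ 0 := (Real.exp_pos _).ne'
  simp only [smul_eq_mul] at h2
  push_cast at h2
  field_simp at h2
  apply Complex.ofReal_injective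
  push_cast
  linear_combination h2

theorem IsCRYamabeSoliton.hess_pde {f : Heis n → ℝ} {μ : ℝ}
    (hv : ∀ t, HasDerivAt v (v' t) t) (hv' : ∀ t, HasDerivAt v' (v'' t) t)
    (h : IsCRYamabeSoliton (confForm n v) f μ) (α : Fin n) (p : Heis n) :
    deriv (Z α) (deriv (Z α) (fun q => (f q : ℂ))) p -
      4 * Complex.I * conj (p.1 α) * v' p.2 * deriv (Z α) (fun q => (f q : ℂ)) p +
      2 * (conj (p.1 α)) ^ 2 * (v'' p.2 - 2 * (v' p.2) ^ 2) * f p = 0 := by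
  obtain ⟨hps, -, T, ϑ, Γ, τ, hco, htw, -, h1⟩ := h
  have h2 := h1 α p
  rw [hess_confForm hv hps hco htw, torsion_confForm hv hv' hps hco htw] at h2
  linear_combination h2 + 2 * (conj (p.1 α)) ^ 2 * (v'' p.2 - 2 * (v' p.2) ^ 2) * f p *
    Complex.I_sq

end Conformal

end HeisenbergCR

/-! ### Functions of the form `A + Bw + Cw̄ + D|w|²` in each complex variable. -/

/-- Induction on the number of variables. For each value of the first variable the remaining ones
give a coefficient family; the dependence on the first variable is recovered by interpolation at `0,
1, -1, i`, four points which determine `A, B, C, D`. -/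
theorem exists_coeff_of_separately_affine :
    ∀ (n : ℕ) (φ : (Fin n → ℂ) → ℂ),
      (∀ z α, ∃ A B C D : ℂ, ∀ w,
        φ (Function.update z α w) = A + B * w + C * conj w + D * (w * conj w)) →
      ∃ C : (Fin n → Fin 2) → (Fin n → Fin 2) → ℂ, ∀ z,
        φ z = ∑ p, ∑ q, C p q * ∏ i, (z i ^ (p i : ℕ) * conj (z i) ^ (q i : ℕ))
  | 0, φ, _ => ⟨fun _ _ => φ 0, fun z => by simp [Subsingleton.elim z 0]⟩
  | n + 1, φ, h => by
    have h1 : ∀ w, ∃ C : (Fin n → Fin 2) → (Fin n → Fin 2) → ℂ, ∀ z, φ (Fin.cons w z) =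
        ∑ p, ∑ q, C p q * ∏ i, (z i ^ (p i : ℕ) * conj (z i) ^ (q i : ℕ)) := by
      intro w
      refine exists_coeff_of_separately_affine n (fun z => φ (Fin.cons w z)) fun z α => ?_
      obtain ⟨A, B, C, D, h2⟩ := h (Fin.cons w z) α.succ
      exact ⟨A, B, C, D, fun x => by rw [← h2, Fin.cons_update]⟩
    choose C hC using h1
    -- Interpolation formulas: `c11` is `D`, `s` is `B + C` and `e` is `B - C`, read off from the
    -- values at `1`, `-1` and `i`.
    let c11 := fun p q => (C 1 p q + C (-1) p q) / 2 - C 0 p q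
    let s := fun p q => (C 1 p q - C (-1) p q) / 2
    let e := fun p q => -Complex.I * (C Complex.I p q - C 0 p q - c11 p q)
    refine ⟨fun p q => ![![C 0 (Fin.tail p) (Fin.tail q),
        (s (Fin.tail p) (Fin.tail q) - e (Fin.tail p) (Fin.tail q)) / 2],
        ![(s (Fin.tail p) (Fin.tail q) + e (Fin.tail p) (Fin.tail q)) / 2,
          c11 (Fin.tail p) (Fin.tail q)]] (p 0) (q 0), fun z => ?_⟩
    have hsum : ∀ F : (Fin (n + 1) → Fin 2) → ℂ,
        ∑ p, F p = (∑ p, F (Fin.cons 0 p)) + ∑ p, F (Fin.cons 1 p) := by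
      intro F
      rw [← (Fin.consEquiv (fun _ => Fin 2)).sum_comp, Fintype.sum_prod_type, Fin.sum_univ_two]
      rfl
    obtain ⟨w, x, rfl⟩ : ∃ w x, z = Fin.cons w x := ⟨z 0, Fin.tail z, (Fin.cons_self_tail z).symm⟩
    obtain ⟨a, b, c, k, h2⟩ := h (Fin.cons 0 x) 0
    simp only [Fin.update_cons_zero] at h2
    have h00 := h2 0
    have h01 := h2 1
    have h0m := h2 (-1)
    have h0i := h2 Complex.I
    rw [hC] at h00 h01 h0m h0i
    simp only [map_zero, map_one, map_neg, Complex.conj_I] at h00 h01 h0m h0i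
    rw [h2]
    simp only [hsum, Fin.prod_univ_succ, Fin.cons_zero, Fin.cons_succ, Fin.tail_cons,
      Matrix.cons_val_zero, Matrix.cons_val_one, Fin.val_zero, Fin.val_one, pow_zero, pow_one,
      mul_one, one_mul]
    simp only [Finset.sum_add_distrib, c11, s, e]
    set M : (Fin n → Fin 2) → (Fin n → Fin 2) → ℂ :=
      fun p q => ∏ i, (x i ^ (p i : ℕ) * conj (x i) ^ (q i : ℕ)) with hM
    have key : ∀ (u : (Fin n → Fin 2) → (Fin n → Fin 2) → ℂ) (y : ℂ),
        ∑ p, ∑ q, u p q * (y * M p q) = y * ∑ p, ∑ q, u p q * M p q := by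
      intro u y
      simp only [Finset.mul_sum]
      exact Finset.sum_congr rfl fun p _ => Finset.sum_congr rfl fun q _ => by ring
    rw [key, key, key]
    have key2 : ∀ (a0 a1 a2 a3 : ℂ), ∑ p, ∑ q, (a0 * C 0 p q + a1 * C 1 p q + a2 * C (-1) p q +
        a3 * C Complex.I p q) * M p q =
        a0 * (∑ p, ∑ q, C 0 p q * M p q) + a1 * (∑ p, ∑ q, C 1 p q * M p q) +
        a2 * (∑ p, ∑ q, C (-1) p q * M p q) + a3 * (∑ p, ∑ q, C Complex.I p q * M p q) := by
      intro a0 a1 a2 a3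
      simp only [Finset.mul_sum, ← Finset.sum_add_distrib]
      exact Finset.sum_congr rfl fun p _ => Finset.sum_congr rfl fun q _ => by ring
    have e1 := key2 0 (1 / 4 - Complex.I / 4) (-1 / 4 - Complex.I / 4) (Complex.I / 2)
    have e2 := key2 0 (1 / 4 + Complex.I / 4) (-1 / 4 + Complex.I / 4) (-Complex.I / 2)
    have e3 := key2 (-1) (1 / 2) (1 / 2) 0
    rw [h00, h01, h0m, h0i] at e1 e2 e3
    have hI := Complex.I_sq
    rw [h00, Finset.sum_congr rfl fun p _ => Finset.sum_congr rfl fun q _ => congrArg (· * M p q)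
      (show _ = 0 * C 0 p q + (1 / 4 - Complex.I / 4) * C 1 p q +
        (-1 / 4 - Complex.I / 4) * C (-1) p q + (Complex.I / 2) * C Complex.I p q by ring), e1,
      Finset.sum_congr rfl fun p _ => Finset.sum_congr rfl fun q _ => congrArg (· * M p q)
      (show _ = 0 * C 0 p q + (1 / 4 + Complex.I / 4) * C 1 p q +
        (-1 / 4 + Complex.I / 4) * C (-1) p q + (-Complex.I / 2) * C Complex.I p q by ring), e2,
      Finset.sum_congr rfl fun p _ => Finset.sum_congr rfl fun q _ => congrArg (· * M p q)
      (show _ = (-1) * C 0 p q + (1 / 2) * C 1 p q +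
        (1 / 2) * C (-1) p q + 0 * C Complex.I p q by ring), e3]
    linear_combination (-(w * k * Complex.I / 2) + conj w * k * Complex.I / 2 +
      (b - c) * (w - conj w) / 2) * hI

/-- A function on `ℂ` whose gradient `(P, Q)` satisfies `P_x = Q_y`, `P_y = Q_x = 0`. -/
theorem eq_affine_add_normSq {ψ P Q R : ℂ → ℝ}
    (hψ : ∀ w, HasFDerivAt ψ (P w • Complex.reCLM + Q w • Complex.imCLM) w)
    (hP : ∀ w, HasFDerivAt P (R w • Complex.reCLM) w)
    (hQ : ∀ w, HasFDerivAt Q (R w • Complex.imCLM) w) (w : ℂ) :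
    ψ w = ψ 0 + P 0 * w.re + Q 0 * w.im + R 0 / 2 * Complex.normSq w := by
  have hline : ∀ (w c : ℂ) (s : ℝ), HasDerivAt (fun r : ℝ => w + r * c) c s := fun w c s => by
    simpa using ((Complex.ofRealCLM.hasDerivAt (x := s)).mul_const c).const_add w
  have hPc : ∀ w : ℂ, ∀ y : ℝ, P (w + y * Complex.I) = P w := by
    intro w y
    have h : ∀ s, HasDerivAt (fun r : ℝ => P (w + r * Complex.I)) 0 s := fun s => by
      have := (hP (w + s * Complex.I)).comp_hasDerivAt s (hline w Complex.I s)
      rwa [show (R (w + s * Complex.I) • Complex.reCLM) Complex.I = 0 by simp] at this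
    have := is_const_of_deriv_eq_zero (fun s => (h s).differentiableAt) (fun s => (h s).deriv) y 0
    simpa using this
  have hQc : ∀ w : ℂ, ∀ x : ℝ, Q (w + x * 1) = Q w := by
    intro w x
    have h : ∀ s, HasDerivAt (fun r : ℝ => Q (w + r * 1)) 0 s := fun s => by
      have := (hQ (w + s * 1)).comp_hasDerivAt s (hline w 1 s)
      rwa [show (R (w + s * 1) • Complex.imCLM) 1 = 0 by simp] at this
    have := is_const_of_deriv_eq_zero (fun s => (h s).differentiableAt) (fun s => (h s).deriv) x 0
    simpa using this
  -- `R` is the `x`-derivative of `P`, which ignores `y`, and likewise the `y`-derivative of `Q`,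
  -- which ignores `x`; so `R` depends on neither variable.
  have hR1 : ∀ w : ℂ, ∀ y : ℝ, R (w + y * Complex.I) = R w := by
    intro w y
    have h1 := (hP (w + y * Complex.I + (0 : ℝ) * 1)).comp_hasDerivAt 0
      (hline (w + y * Complex.I) 1 0)
    have h2 := (hP (w + (0 : ℝ) * 1)).comp_hasDerivAt 0 (hline w 1 0)
    have h3 : (P ∘ fun r : ℝ => w + y * Complex.I + r * 1) = P ∘ fun r : ℝ => w + r * 1 := by
      funext r
      simp only [Function.comp]
      rw [add_right_comm, hPc]
    rw [h3] at h1
    simpa using h1.unique h2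
  have hR2 : ∀ w : ℂ, ∀ x : ℝ, R (w + x * 1) = R w := by
    intro w x
    have h1 := (hQ (w + x * 1 + (0 : ℝ) * Complex.I)).comp_hasDerivAt 0
      (hline (w + x * 1) Complex.I 0)
    have h2 := (hQ (w + (0 : ℝ) * Complex.I)).comp_hasDerivAt 0 (hline w Complex.I 0)
    have h3 : (Q ∘ fun r : ℝ => w + x * 1 + r * Complex.I) =
        Q ∘ fun r : ℝ => w + r * Complex.I := by
      funext r
      simp only [Function.comp]
      rw [add_right_comm, hQc]
    rw [h3] at h1
    simpa using h1.unique h2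
  have hR : ∀ w, R w = R 0 := fun w => by
    have h := hR1 (0 + w.re * 1) w.im
    rw [hR2] at h
    simpa using h
  have hPw : ∀ w : ℂ, P w = P 0 + R 0 * w.re := by
    intro w
    have h : ∀ w, HasFDerivAt (fun w => P w - R 0 * w.re) (0 : ℂ →L[ℝ] ℝ) w := fun w => by
      have := (hP w).sub (Complex.reCLM.hasFDerivAt.const_mul (R 0))
      rw [hR w, sub_self] at this
      exact this
    have := is_const_of_fderiv_eq_zero (𝕜 := ℝ) (fun w => (h w).differentiableAt)
      (fun w => (h w).fderiv) w 0
    simp at this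
    linarith
  have hQw : ∀ w : ℂ, Q w = Q 0 + R 0 * w.im := by
    intro w
    have h : ∀ w, HasFDerivAt (fun w => Q w - R 0 * w.im) (0 : ℂ →L[ℝ] ℝ) w := fun w => by
      have := (hQ w).sub (Complex.imCLM.hasFDerivAt.const_mul (R 0))
      rw [hR w, sub_self] at this
      exact this
    have := is_const_of_fderiv_eq_zero (𝕜 := ℝ) (fun w => (h w).differentiableAt)
      (fun w => (h w).fderiv) w 0
    simp at this
    linarith
  have h : ∀ w : ℂ, HasFDerivAt (fun w : ℂ => ψ w - (P 0 * w.re + Q 0 * w.im +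
      R 0 / 2 * (w.re * w.re + w.im * w.im))) (0 : ℂ →L[ℝ] ℝ) w := fun w => by
    have hre := Complex.reCLM.hasFDerivAt (x := w)
    have him := Complex.imCLM.hasFDerivAt (x := w)
    have := (hψ w).sub (((hre.const_mul (P 0)).add (him.const_mul (Q 0))).add
      (((hre.mul hre).add (him.mul him)).const_mul (R 0 / 2)))
    refine this.congr_fderiv ?_
    ext u
    simp [hPw w, hQw w]
    ring
  have := is_const_of_fderiv_eq_zero (𝕜 := ℝ) (fun w => (h w).differentiableAt)
    (fun w => (h w).fderiv) w 0
  simp at this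
  rw [Complex.normSq_apply]
  linarith

/-! ### Commutation relations for iterated derivatives of a function. -/

namespace HeisenbergCR

variable {n : ℕ}

theorem contDiff_deriv_Z {φ : Heis n → ℂ} (h : ContDiff ℝ ∞ φ) (α : Fin n) :
    ContDiff ℝ ∞ (deriv (Z α) φ) := by
  have h1 : ContDiff ℝ ∞ (fderiv ℝ φ) := h.fderiv_right (by simp)
  have h2 : ∀ w, ContDiff ℝ ∞ fun q => fderiv ℝ φ q w := fun w => h1.clm_apply contDiff_const
  have h3 : ContDiff ℝ ∞ fun q : Heis n => conj (q.1 α) := (conjForm (dz n α)).contDiff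
  have : deriv (Z α) φ = fun q => _ := funext fun q => ev_Z (fderiv ℝ φ q) α q
  rw [this]
  exact (((h2 _).sub (contDiff_const.mul (h2 _))).div_const _).add
    ((contDiff_const.mul h3).mul (h2 _))

theorem contDiff_deriv_bar_Z {φ : Heis n → ℂ} (h : ContDiff ℝ ∞ φ) (α : Fin n) :
    ContDiff ℝ ∞ (deriv (fun q => (Z α q).bar) φ) := by
  have h1 : ContDiff ℝ ∞ (fderiv ℝ φ) := h.fderiv_right (by simp)
  have h2 : ∀ w, ContDiff ℝ ∞ fun q => fderiv ℝ φ q w := fun w => h1.clm_apply contDiff_const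
  have h3 : ContDiff ℝ ∞ fun q : Heis n => q.1 α := (dz n α).contDiff
  have : deriv (fun q => (Z α q).bar) φ = fun q => _ :=
    funext fun q => ev_bar_Z (fderiv ℝ φ q) α q
  rw [this]
  exact (((h2 _).add (contDiff_const.mul (h2 _))).div_const _).sub
    ((contDiff_const.mul h3).mul (h2 _))

theorem contDiff_fderiv_Dt {φ : Heis n → ℂ} (h : ContDiff ℝ ∞ φ) :
    ContDiff ℝ ∞ (fun q => fderiv ℝ φ q (0, 1)) := by
  have h1 : ContDiff ℝ ∞ (fderiv ℝ φ) := h.fderiv_right (by simp)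
  exact h1.clm_apply contDiff_const

theorem d_fderiv {φ : Heis n → ℂ} (h : ContDiff ℝ ∞ φ) (p v w : Heis n) :
    d (fderiv ℝ φ) p v w = 0 := by
  rw [d, sub_eq_zero]
  exact (h.contDiffAt.isSymmSndFDerivAt (by
    rw [minSmoothness_of_isRCLikeNormedField]; exact WithTop.coe_le_coe.2 le_top)).eq v w

theorem differentiableAt_fderiv {φ : Heis n → ℂ} (h : ContDiff ℝ ∞ φ) (p : Heis n) :
    DifferentiableAt ℝ (fderiv ℝ φ) p :=
  (h.fderiv_right (m := ∞) (by simp)).differentiable (by simp) p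

/-- The commutation rules here come from applying the formulas for `dη` to the closed form `η = dφ`.
-/
theorem deriv_Z_bar_Z {φ : Heis n → ℂ} (h : ContDiff ℝ ∞ φ) (α : Fin n) (p : Heis n) :
    deriv (Z α) (deriv (fun q => (Z α q).bar) φ) p =
      deriv (fun q => (Z α q).bar) (deriv (Z α) φ) p - 2 * Complex.I * fderiv ℝ φ p (0, 1) := by
  have h1 := ev₂_d_Z_bar (differentiableAt_fderiv h p) α α
  rw [ev₂_congr (c := fun _ _ => 0) (d_fderiv h p)] at h1
  simp only [ev₂, if_true] at h1
  change _ = deriv (Z α) (deriv (fun q => (Z α q).bar) φ) p -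
    deriv (fun q => (Z α q).bar) (deriv (Z α) φ) p + _ at h1
  linear_combination -h1

theorem fderiv_Dt_deriv_Z {φ : Heis n → ℂ} (h : ContDiff ℝ ∞ φ) (α : Fin n) (p : Heis n) :
    deriv (Z α) (fun q => fderiv ℝ φ q (0, 1)) p = fderiv ℝ (deriv (Z α) φ) p (0, 1) := by
  have h1 := ev₂_d_Dt_Z (differentiableAt_fderiv h p) α
  rw [ev₂_congr (c := fun _ _ => 0) (d_fderiv h p)] at h1
  simp only [ev₂] at h1
  change _ = fderiv ℝ (deriv (Z α) φ) p (0, 1) - _ at h1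
  linear_combination h1

theorem fderiv_Dt_deriv_bar_Z {φ : Heis n → ℂ} (h : ContDiff ℝ ∞ φ) (α : Fin n) (p : Heis n) :
    deriv (fun q => (Z α q).bar) (fun q => fderiv ℝ φ q (0, 1)) p =
      fderiv ℝ (deriv (fun q => (Z α q).bar) φ) p (0, 1) := by
  have h1 := ev₂_d_Dt_bar (differentiableAt_fderiv h p) α
  rw [ev₂_congr (c := fun _ _ => 0) (d_fderiv h p)] at h1
  simp only [ev₂] at h1
  change _ = fderiv ℝ (deriv (fun q => (Z α q).bar) φ) p (0, 1) - _ at h1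
  linear_combination h1

theorem deriv_sub_const_mul (V : Heis n → CVec n) {φ ψ : Heis n → ℂ} (hφ : ContDiff ℝ ∞ φ)
    (hψ : ContDiff ℝ ∞ ψ) (c : ℂ) (p : Heis n) :
    deriv V (fun q => φ q - c * ψ q) p = deriv V φ p - c * deriv V ψ p := by
  have h1 := differentiableAt_of_contDiff hφ p
  have h2 := differentiableAt_of_contDiff hψ p
  simp only [sub_eq_add_neg, ← neg_mul]
  rw [deriv_add V h1 (h2.const_mul _), deriv_const_mul V _ h2]

/-- If `Z Z φ = 0` and `Z̄ Z̄ φ = 0` then `(Z Z̄ + Z̄ Z) φ` does not depend on `t`. -/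
theorem fderiv_Dt_sublaplacian {φ : Heis n → ℂ} (h : ContDiff ℝ ∞ φ) (α : Fin n)
    (h1 : ∀ p, deriv (Z α) (deriv (Z α) φ) p = 0)
    (h2 : ∀ p, deriv (fun q => (Z α q).bar) (deriv (fun q => (Z α q).bar) φ) p = 0) (p : Heis n) :
    fderiv ℝ (fun q => deriv (Z α) (deriv (fun q => (Z α q).bar) φ) q +
      deriv (fun q => (Z α q).bar) (deriv (Z α) φ) q) p (0, 1) = 0 := by
  have hZ := contDiff_deriv_Z h α
  have hB := contDiff_deriv_bar_Z h α
  have hZB := contDiff_deriv_Z hB α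
  have hBZ := contDiff_deriv_bar_Z hZ α
  have hT := contDiff_fderiv_Dt h
  rw [fderiv_fun_add (differentiableAt_of_contDiff hZB p) (differentiableAt_of_contDiff hBZ p),
    add_apply]
  -- `Z Z̄ Z̄ φ = 0`
  have e1 : (fun q => deriv (fun q => (Z α q).bar) (deriv (Z α) (deriv (fun q => (Z α q).bar) φ)) q
      - 2 * Complex.I * fderiv ℝ (deriv (fun q => (Z α q).bar) φ) q (0, 1)) = fun _ => 0 := by
    funext q
    rw [← deriv_Z_bar_Z hB, show deriv (fun q => (Z α q).bar) (deriv (fun q => (Z α q).bar) φ) =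
      fun _ => 0 from funext h2, deriv_const]
  have e2 : deriv (Z α) (deriv (fun q => (Z α q).bar) φ) = fun q =>
      deriv (fun q => (Z α q).bar) (deriv (Z α) φ) q - 2 * Complex.I * fderiv ℝ φ q (0, 1) :=
    funext (deriv_Z_bar_Z h α)
  have e3 : (fun q => deriv (fun q => (Z α q).bar) (deriv (fun q => (Z α q).bar) (deriv (Z α) φ)) q
      - 4 * Complex.I * fderiv ℝ (deriv (fun q => (Z α q).bar) φ) q (0, 1)) = fun _ => 0 := by
    rw [← e1]
    funext q
    conv_rhs => rw [e2]
    rw [deriv_sub_const_mul _ hBZ hT, fderiv_Dt_deriv_bar_Z h]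
    ring
  -- Apply `Z` to `Z̄Z̄Zφ = 4i ∂_t Z̄φ`. Since `ZZφ = 0` gives `ZZ̄Zφ = -2i ∂_t Zφ`, commuting `Z`
  -- inward yields `-4i ∂_t (Z̄Z + ZZ̄)φ = 0`.
  have e4 := congrArg (fun ψ => deriv (Z α) ψ p) e3
  simp only [deriv_const] at e4
  rw [deriv_sub_const_mul _ (contDiff_deriv_bar_Z hBZ α) (contDiff_fderiv_Dt hB),
    fderiv_Dt_deriv_Z hB, deriv_Z_bar_Z hBZ] at e4
  have e5 : deriv (Z α) (deriv (fun q => (Z α q).bar) (deriv (Z α) φ)) =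
      fun q => 0 - 2 * Complex.I * fderiv ℝ (deriv (Z α) φ) q (0, 1) := by
    funext q
    rw [deriv_Z_bar_Z hZ, show deriv (Z α) (deriv (Z α) φ) = fun _ => 0 from funext h1,
      deriv_const]
  rw [e5, deriv_sub_const_mul _ contDiff_const (contDiff_fderiv_Dt hZ), deriv_const,
    fderiv_Dt_deriv_bar_Z hZ] at e4
  linear_combination (Complex.I / 4) * e4 + (fderiv ℝ
    (deriv (Z α) (deriv (fun q => (Z α q).bar) φ)) p (0, 1) + fderiv ℝ
    (deriv (fun q => (Z α q).bar) (deriv (Z α) φ)) p (0, 1)) * Complex.I_sq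

/-- On the axis `z = 0` the frame has no `∂_t` component, and the two first-order corrections cancel
in the sum, leaving a pure Hessian in the `z_α` plane. -/
theorem sublaplacian_eq {φ : Heis n → ℂ} (h : ContDiff ℝ ∞ φ) (α : Fin n) (t : ℝ) :
    deriv (Z α) (deriv (fun q => (Z α q).bar) φ) (0, t) +
      deriv (fun q => (Z α q).bar) (deriv (Z α) φ) (0, t) =
    2 * (fderiv ℝ (fderiv ℝ φ) (0, t) (Pi.single α (1 / 2), 0) (Pi.single α (1 / 2), 0) +
      fderiv ℝ (fderiv ℝ φ) (0, t) (Pi.single α (-(Complex.I / 2)), 0)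
        (Pi.single α (-(Complex.I / 2)), 0)) := by
  have h1 := ev₂_fderiv_Z (differentiableAt_fderiv h (0, t)) α (Z α (0, t)).bar
  have h2 := ev₂_fderiv_bar_Z (differentiableAt_fderiv h (0, t)) α (Z α (0, t))
  rw [ev_conj_dz_bar_Z] at h1
  rw [ev_dz_Z] at h2
  change _ = deriv (fun q => (Z α q).bar) (deriv (Z α) φ) (0, t) - _ at h1
  change _ = deriv (Z α) (deriv (fun q => (Z α q).bar) φ) (0, t) + _ at h2
  have hz : Z α ((0, t) : Heis n) =
      ((Pi.single α (1 / 2), 0), (Pi.single α (-(Complex.I / 2)), 0)) := by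
    simp [Z]
  simp only [if_true] at h1 h2
  have hb : CVec.bar (((Pi.single α (1 / 2), 0), (Pi.single α (-(Complex.I / 2)), 0)) : CVec n) =
      ((Pi.single α (1 / 2), 0), -(Pi.single α (-(Complex.I / 2)), 0)) := rfl
  rw [hz] at h1 h2
  simp only [ev₂, hb, map_neg, neg_apply] at h1 h2
  linear_combination -h1 - h2

theorem deriv_deriv_Z {φ : Heis n → ℂ} (h : ContDiff ℝ ∞ φ) (α : Fin n) (p : Heis n) :
    deriv (Z α) (deriv (Z α) φ) p =
      ev₂ (fun v w => fderiv ℝ (fderiv ℝ φ) p v w) (Z α p) (Z α p) := by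
  rw [ev₂_fderiv_Z (differentiableAt_fderiv h p), ev_conj_dz_Z]
  change _ = deriv (Z α) (deriv (Z α) φ) p - _
  ring

end HeisenbergCR

/-! ### Rigidity: the conformal factor is constant. -/

/-- The equation says `(e^{kv})'' = 0`, and an affine function that is positive on the whole line
has slope zero. -/
theorem deriv_eq_zero_of_ode {v v' v'' : ℝ → ℝ} {k : ℝ} (hk : 0 < k)
    (hv : ∀ t, HasDerivAt v (v' t) t) (hv' : ∀ t, HasDerivAt v' (v'' t) t)
    (h : ∀ t, v'' t + k * v' t ^ 2 = 0) (t : ℝ) : v' t = 0 := by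
  have he : ∀ t, HasDerivAt (fun t => Real.exp (k * v t)) (k * (v' t * Real.exp (k * v t))) t :=
    fun t => by
      have := ((hv t).const_mul k).exp
      rwa [mul_comm, mul_assoc] at this
  have h1 : ∀ t, HasDerivAt (fun t => v' t * Real.exp (k * v t)) 0 t := fun t => by
    refine ((hv' t).mul (he t)).congr_deriv ?_
    linear_combination Real.exp (k * v t) * h t
  have hc := fun t => is_const_of_deriv_eq_zero (fun s => (h1 s).differentiableAt)
    (fun s => (h1 s).deriv) t 0
  set c := v' 0 * Real.exp (k * v 0) with hcdef
  have h2 : ∀ t, HasDerivAt (fun t => Real.exp (k * v t) - k * c * t) 0 t := fun t => by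
    refine ((he t).sub ((hasDerivAt_id t).const_mul (k * c))).congr_deriv ?_
    rw [hc t]
    ring
  have h3 := fun t => is_const_of_deriv_eq_zero (fun s => (h2 s).differentiableAt)
    (fun s => (h2 s).deriv) t 0
  have hc0 : c = 0 := by
    by_contra hne
    -- The point where the affine function `e^{k v(0)} + k c t` would vanish.
    have h4 := h3 (-(Real.exp (k * v 0) / (k * c)))
    have h5 := Real.exp_pos (k * v (-(Real.exp (k * v 0) / (k * c))))
    have h6 : k * c * -(Real.exp (k * v 0) / (k * c)) = -Real.exp (k * v 0) := by
      field_simp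
    rw [h6] at h4
    linarith
  have h7 := hc t
  rw [hc0] at h7
  exact (mul_eq_zero.1 h7).resolve_right (Real.exp_pos _).ne'

theorem hasDerivAt_integral {k : ℝ → ℝ} (hk : Continuous k) (t : ℝ) :
    HasDerivAt (fun t => ∫ s in (0 : ℝ)..t, k s) (k t) t :=
  (hk.integral_hasStrictDerivAt 0 t).hasDerivAt

namespace HeisenbergCR

variable {n : ℕ} {v v' v'' : ℝ → ℝ}

theorem eq_along_characteristics (hv : ∀ t, HasDerivAt v (v' t) t)
    (hv' : ∀ t, HasDerivAt v' (v'' t) t) (hc : Continuous v'') {f : Heis n → ℝ}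
    (hf : ContDiff ℝ ∞ f) {μ : ℝ}
    (h : ∀ p : Heis n, fderiv ℝ f p (-(v' p.2) • p.1, 1) = 2 * μ * Real.exp (2 * v p.2) +
      4 * (n + 1) * (v'' p.2 + n * (v' p.2) ^ 2) * ∑ β, Complex.normSq (p.1 β))
    (z : Fin n → ℂ) (t : ℝ) :
    f (z, t) = f (Real.exp (v t - v 0) • z, 0) + 2 * μ * (∫ s in (0 : ℝ)..t, Real.exp (2 * v s)) +
      Real.exp (2 * v t) * (∑ β, Complex.normSq (z β)) *
        ∫ s in (0 : ℝ)..t, 4 * (n + 1) * Real.exp (-(2 * v s)) * (v'' s + n * v' s ^ 2) := by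
  have cv : Continuous v := continuous_iff_continuousAt.2 fun t => (hv t).continuousAt
  have cv' : Continuous v' := continuous_iff_continuousAt.2 fun t => (hv' t).continuousAt
  have i1 := hasDerivAt_integral (k := fun s => Real.exp (2 * v s)) (by fun_prop)
  have i2 := hasDerivAt_integral (k := fun s => 4 * (n + 1) * Real.exp (-(2 * v s)) *
    (v'' s + n * v' s ^ 2)) (by fun_prop)
  -- The characteristics are `s ↦ (e^{-v(s)} w, s)`; this `w` selects the one through `(z, t)`,
  -- which meets the slice `t = 0` at `e^{v(t)-v(0)} z`.
  set w : Fin n → ℂ := Real.exp (v t) • z with hw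
  have hS : ∀ (c : ℝ) (x : Fin n → ℂ), ∑ β, Complex.normSq ((c • x) β) =
      c ^ 2 * ∑ β, Complex.normSq (x β) := by
    intro c x
    rw [Finset.mul_sum]
    refine Finset.sum_congr rfl fun β _ => ?_
    rw [Pi.smul_apply, Complex.real_smul, map_mul, Complex.normSq_ofReal]
    ring
  have hF : ∀ s, HasDerivAt (fun s => f (Real.exp (-v s) • w, s) -
      (2 * μ * (∫ r in (0 : ℝ)..s, Real.exp (2 * v r)) + (∑ β, Complex.normSq (w β)) *
        ∫ r in (0 : ℝ)..s, 4 * (n + 1) * Real.exp (-(2 * v r)) * (v'' r + n * v' r ^ 2))) 0 s := by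
    intro s
    have hcurve : HasDerivAt (fun s => ((Real.exp (-v s) • w, s) : Heis n))
        (-(v' s) • Real.exp (-v s) • w, 1) s := by
      have := (((hv s).neg.exp).smul_const w).prodMk (hasDerivAt_id s)
      rwa [mul_comm, mul_smul] at this
    have h1 := HasFDerivAt.comp_hasDerivAt (f := fun s => ((Real.exp (-v s) • w, s) : Heis n)) s
      (differentiableAt_of_contDiff hf (Real.exp (-v s) • w, s)).hasFDerivAt hcurve
    refine (h1.sub (((i1 s).const_mul (2 * μ)).add ((i2 s).const_mul _))).congr_deriv ?_
    have h2 := h (Real.exp (-v s) • w, s)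
    simp only [hS] at h2
    rw [h2, ← Real.exp_nat_mul, show ((2 : ℕ) : ℝ) * -v s = -(2 * v s) by push_cast; ring]
    ring
  have key := is_const_of_deriv_eq_zero (fun s => (hF s).differentiableAt)
    (fun s => (hF s).deriv) t 0
  simp only [intervalIntegral.integral_same, mul_zero, add_zero, sub_zero] at key
  rw [hw, smul_smul, smul_smul, ← Real.exp_add, ← Real.exp_add, neg_add_cancel, Real.exp_zero,
    one_smul, hS, ← Real.exp_nat_mul, show -v 0 + v t = v t - v 0 by ring] at key
  push_cast at key
  linarith

theorem sndDeriv_eq_of_line {φ : Heis n → ℂ} (hφ : ContDiff ℝ ∞ φ) {p X : Heis n}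
    {h h₁ : ℝ → ℂ} {c : ℂ} (e : ∀ s : ℝ, φ (p + s • X) = h s) (hh : ∀ s, HasDerivAt h (h₁ s) s)
    (hh₁ : HasDerivAt h₁ c 0) : fderiv ℝ (fderiv ℝ φ) p X X = c := by
  have hline : ∀ s : ℝ, HasDerivAt (fun s : ℝ => p + s • X) X s := fun s => by
    simpa using ((hasDerivAt_id s).smul_const X).const_add p
  have h1 : ∀ s, fderiv ℝ φ (p + s • X) X = h₁ s := fun s => by
    have := (differentiableAt_of_contDiff hφ (p + s • X)).hasFDerivAt.comp_hasDerivAt s (hline s)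
    rw [show (φ ∘ fun s : ℝ => p + s • X) = h from funext e] at this
    exact this.unique (hh s)
  have h2 : HasFDerivAt (fun q => fderiv ℝ φ q X) ((fderiv ℝ (fderiv ℝ φ) p).flip X)
      (p + (0 : ℝ) • X) := by
    rw [zero_smul, add_zero]
    simpa using (differentiableAt_fderiv hφ p).hasFDerivAt.clm_apply (hasFDerivAt_const X p)
  have h3 := h2.comp_hasDerivAt 0 (hline 0)
  rw [show ((fun q => fderiv ℝ φ q X) ∘ fun s : ℝ => p + s • X) = h₁ from funext h1] at h3
  exact h3.unique hh₁

theorem contDiff_ofReal_comp {f : Heis n → ℝ} (hf : ContDiff ℝ ∞ f) :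
    ContDiff ℝ ∞ fun q => (f q : ℂ) :=
  Complex.ofRealCLM.contDiff.comp hf

theorem deriv_bar_Z_conj {φ : Heis n → ℂ} (hφ : ContDiff ℝ ∞ φ) (α : Fin n) (p : Heis n) :
    deriv (fun q => (Z α q).bar) (fun q => conj (φ q)) p = conj (deriv (Z α) φ p) := by
  have h : HasFDerivAt (fun q => conj (φ q)) (conjForm (fderiv ℝ φ p)) p :=
    (Complex.conjCLE : ℂ →L[ℝ] ℂ).hasFDerivAt.comp p
      (differentiableAt_of_contDiff hφ p).hasFDerivAt
  rw [deriv, h.fderiv, ev_conjForm, bar_bar, deriv]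

/-- The torsion equation in terms of `g = e^{-2v} f`. -/
theorem deriv_deriv_Z_conformal (hv : ∀ t, HasDerivAt v (v' t) t)
    (hv' : ∀ t, HasDerivAt v' (v'' t) t) {φ : Heis n → ℂ}
    (hφ : ContDiff ℝ ∞ φ) (α : Fin n)
    (h : ∀ p, deriv (Z α) (deriv (Z α) φ) p -
      4 * Complex.I * conj (p.1 α) * v' p.2 * deriv (Z α) φ p +
      2 * (conj (p.1 α)) ^ 2 * (v'' p.2 - 2 * (v' p.2) ^ 2) * φ p = 0) (p : Heis n) :
    deriv (Z α) (deriv (Z α) (fun q => (Real.exp (-(2 * v q.2)) : ℂ) * φ q)) p = 0 := by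
  have hE : ∀ p : Heis n, HasDerivAt (fun s => Real.exp (-(2 * v s)))
      (-(2 * v' p.2) * Real.exp (-(2 * v p.2))) p.2 := fun p => by
    have := ((hv p.2).const_mul 2).neg.exp
    rwa [mul_comm] at this
  have hZ := contDiff_deriv_Z hφ α
  have e1 : deriv (Z α) (fun q => (Real.exp (-(2 * v q.2)) : ℂ) * φ q) = fun q =>
      (Real.exp (-(2 * v q.2)) : ℂ) * (deriv (Z α) φ q +
        (-2 * Complex.I) * ((conj (q.1 α) * (v' q.2 : ℂ)) * φ q)) := by
    funext q
    rw [deriv_mul' _ (differentiableAt_time (hE q)) (differentiableAt_of_contDiff hφ q),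
      deriv_time_Z (hE q)]
    push_cast
    ring
  have d1 : DifferentiableAt ℝ (fun q : Heis n => conj (q.1 α) * (v' q.2 : ℂ)) p :=
    (differentiable_conj_coord α p).mul (differentiableAt_time (hv' p.2))
  have d2 : DifferentiableAt ℝ (fun q : Heis n => conj (q.1 α) * (v' q.2 : ℂ) * φ q) p :=
    d1.mul (differentiableAt_of_contDiff hφ p)
  have d3 := differentiableAt_of_contDiff hZ p
  rw [e1, deriv_mul' _ (differentiableAt_time (hE p)) (d3.fun_add (d2.const_mul _)),
    deriv_time_Z (hE p), deriv_add _ d3 (d2.const_mul _), deriv_const_mul _ _ d2,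
    deriv_mul' _ d1 (differentiableAt_of_contDiff hφ p), deriv_conj_mul_time_Z (hv' p.2)]
  push_cast
  linear_combination Complex.exp (-(2 * (v p.2 : ℂ))) * h p +
    Complex.exp (-(2 * (v p.2 : ℂ))) * (conj (p.1 α)) ^ 2 * φ p *
      (4 * (v' p.2) ^ 2 - 2 * v'' p.2) * Complex.I_sq

/-- The conformal factor of a soliton is constant when `n ≥ 1`. -/
theorem deriv_conformal_eq_zero (hv : ∀ t, HasDerivAt v (v' t) t)
    (hv' : ∀ t, HasDerivAt v' (v'' t) t) (hvs : ContDiff ℝ ∞ v) (hc : Continuous v'')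
    {f : Heis n → ℝ} {μ : ℝ} (hf : IsCRYamabeSoliton (confForm n v) f μ) (α : Fin n) (t : ℝ) :
    v' t = 0 := by
  have hfs : ContDiff ℝ ∞ f := hf.2.1
  have hF := contDiff_ofReal_comp hfs
  have hform := eq_along_characteristics hv hv' hc hfs (hf.characteristic_pde hv hv')
  have cv : Continuous v := continuous_iff_continuousAt.2 fun t => (hv t).continuousAt
  have cv' : Continuous v' := continuous_iff_continuousAt.2 fun t => (hv' t).continuousAt
  have hκ := hasDerivAt_integral (k := fun s => 4 * (n + 1) * Real.exp (-(2 * v s)) *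
    (v'' s + n * v' s ^ 2)) (by fun_prop)
  set κ : ℝ → ℝ := fun t => ∫ s in (0 : ℝ)..t, 4 * (n + 1) * Real.exp (-(2 * v s)) *
    (v'' s + n * v' s ^ 2) with hκdef
  set I : ℝ → ℝ := fun t => ∫ s in (0 : ℝ)..t, Real.exp (2 * v s) with hIdef
  set g : Heis n → ℂ := fun q => (Real.exp (-(2 * v q.2)) : ℂ) * f q with hg
  have hgs : ContDiff ℝ ∞ g := by
    refine ContDiff.mul ?_ hF
    refine Complex.ofRealCLM.contDiff.comp ?_
    exact (contDiff_const.mul (hvs.comp contDiff_snd)).neg.exp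
  have hZZ := deriv_deriv_Z_conformal hv hv' hF α (hf.hess_pde hv hv' α)
  have hconj : g = fun q => conj (g q) := by
    funext q
    simp only [hg, map_mul, Complex.conj_ofReal]
  have hBB : ∀ p, deriv (fun q => (Z α q).bar) (deriv (fun q => (Z α q).bar) g) p = 0 := by
    intro p
    have e : deriv (fun q => (Z α q).bar) g = fun q => conj (deriv (Z α) g q) := by
      funext q
      conv_lhs => rw [hconj]
      exact deriv_bar_Z_conj hgs α q
    rw [e, deriv_bar_Z_conj (contDiff_deriv_Z hgs α), hZZ, map_zero]
  -- By `hform`, `f` on slice `t` is a dilate of `f` on slice `0` plus a function of `t` and a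
  -- multiple of `|z|²`. The square of the dilation factor `l` combines with `e^{-2v(t)}` to the
  -- constant `e^{-2v(0)}`, so only `κ` retains a dependence on `t`.
  have hsnd : ∀ (x : Fin n → ℂ) (t : ℝ), fderiv ℝ (fderiv ℝ g) (0, t) (x, 0) (x, 0) =
      (Real.exp (-(2 * v 0)) : ℂ) *
        fderiv ℝ (fderiv ℝ fun q => (f q : ℂ)) (0, 0) (x, 0) (x, 0) +
      2 * (∑ β, Complex.normSq (x β) : ℝ) * (κ t : ℂ) := by
    intro x t
    set l : ℝ := Real.exp (v t - v 0) with hl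
    set F : Heis n → ℂ := fun q => (f q : ℂ) with hFdef
    have hEE : (Real.exp (-(2 * v t)) : ℂ) * (Real.exp (2 * v t) : ℂ) = 1 := by
      rw [← Complex.ofReal_mul, ← Real.exp_add]; simp
    have hEl : (Real.exp (-(2 * v t)) : ℂ) * (l : ℂ) ^ 2 = (Real.exp (-(2 * v 0)) : ℂ) := by
      rw [hl, ← Complex.ofReal_pow, ← Complex.ofReal_mul, ← Real.exp_nat_mul, ← Real.exp_add]
      congr 2
      push_cast
      ring
    have hline : ∀ s : ℝ, HasDerivAt (fun s : ℝ => (s • (l • x, 0) : Heis n)) (l • x, 0) s :=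
      fun s => by simpa using (hasDerivAt_id s).smul_const ((l • x, 0) : Heis n)
    have h1 : ∀ s : ℝ, HasDerivAt (fun s : ℝ => F (s • (l • x, 0)))
        (fderiv ℝ F (s • (l • x, 0)) (l • x, 0)) s := fun s =>
      (differentiableAt_of_contDiff hF _).hasFDerivAt.comp_hasDerivAt s (hline s)
    have h2 : HasDerivAt (fun s : ℝ => fderiv ℝ F (s • (l • x, 0)) (l • x, 0))
        (fderiv ℝ (fderiv ℝ F) (0, 0) (l • x, 0) (l • x, 0)) 0 := by
      have h3 : HasFDerivAt (fun q => fderiv ℝ F q (l • x, 0))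
          ((fderiv ℝ (fderiv ℝ F) (0, 0)).flip (l • x, 0)) ((0 : ℝ) • (l • x, 0)) := by
        rw [zero_smul, show (0 : Heis n) = (0, 0) from rfl]
        simpa using (differentiableAt_fderiv hF (0, 0)).hasFDerivAt.clm_apply
          (hasFDerivAt_const (l • x, 0) (0, 0))
      exact h3.comp_hasDerivAt 0 (hline 0)
    have hl2 : fderiv ℝ (fderiv ℝ F) (0, 0) (l • x, 0) (l • x, 0) =
        (l : ℂ) ^ 2 * fderiv ℝ (fderiv ℝ F) (0, 0) (x, 0) (x, 0) := by
      have : ((l • x, 0) : Heis n) = l • (x, 0) := by simp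
      rw [this]
      simp only [map_smul, smul_apply, Complex.real_smul]
      ring
    have hsq : ∀ s : ℝ, HasDerivAt (fun s : ℝ => (s : ℂ) ^ 2) (2 * (s : ℂ)) s := fun s => by
      refine ((Complex.ofRealCLM.hasDerivAt (x := s)).pow 2).congr_deriv ?_
      simp
    refine sndDeriv_eq_of_line hgs
      (h := fun s => (Real.exp (-(2 * v t)) : ℂ) * (F (s • (l • x, 0)) + 2 * μ * I t) +
        (s : ℂ) ^ 2 * ((∑ β, Complex.normSq (x β) : ℝ) * (κ t : ℂ)))
      (h₁ := fun s => (Real.exp (-(2 * v t)) : ℂ) * fderiv ℝ F (s • (l • x, 0)) (l • x, 0) +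
        2 * (s : ℂ) * ((∑ β, Complex.normSq (x β) : ℝ) * (κ t : ℂ))) ?_ ?_ ?_
    · intro s
      have hp : ((0, t) : Heis n) + s • (x, 0) = (s • x, t) := by simp
      have hN : ∑ β, Complex.normSq ((s • x) β) = s ^ 2 * ∑ β, Complex.normSq (x β) := by
        rw [Finset.mul_sum]
        refine Finset.sum_congr rfl fun β _ => ?_
        rw [Pi.smul_apply, Complex.real_smul, map_mul, Complex.normSq_ofReal]
        ring
      have hq : (s • (l • x, 0) : Heis n) = (l • s • x, 0) := by simp [smul_comm s l x]
      rw [hp, hq]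
      simp only [hg, hFdef]
      rw [hform, hN]
      simp only [Complex.ofReal_add, Complex.ofReal_mul, Complex.ofReal_pow, Complex.ofReal_ofNat]
      linear_combination (s ^ 2 * (∑ β, Complex.normSq (x β) : ℝ) * (κ t : ℂ)) * hEE
    · intro s
      exact (((h1 s).add_const _).const_mul _).add ((hsq s).mul_const _)
    · rw [← hEl, mul_assoc _ (_ ^ 2), ← hl2]
      refine ((h2.const_mul _).add (((Complex.ofRealCLM.hasDerivAt (x := (0 : ℝ))).const_mul
        2).mul_const _)).congr_deriv ?_
      simp
      ring
  have hnorm : ∀ c : ℂ, ∑ β, Complex.normSq ((Pi.single α c : Fin n → ℂ) β) =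
      Complex.normSq c := fun c => by
    rw [Finset.sum_eq_single α (fun b _ hb => by simp [hb]) (by simp)]
    simp
  -- The two directions `1/2` and `-i/2` each have squared norm `1/4`, whence the coefficient `2 ·
  -- (2 · 1/4 + 2 · 1/4) = 2` of `κ`.
  have hlap : ∀ t : ℝ, deriv (Z α) (deriv (fun q => (Z α q).bar) g) (0, t) +
      deriv (fun q => (Z α q).bar) (deriv (Z α) g) (0, t) =
      deriv (Z α) (deriv (fun q => (Z α q).bar) g) (0, 0) +
      deriv (fun q => (Z α q).bar) (deriv (Z α) g) (0, 0) + 2 * κ t := by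
    intro t
    rw [sublaplacian_eq hgs, sublaplacian_eq hgs, hsnd, hsnd, hsnd, hsnd, hnorm, hnorm]
    have h0 : κ 0 = 0 := by simp [hκdef]
    rw [h0]
    simp
    norm_num
    ring
  have hLs := (contDiff_deriv_Z (contDiff_deriv_bar_Z hgs α) α).add
    (contDiff_deriv_bar_Z (contDiff_deriv_Z hgs α) α)
  have hκ0 : ∀ t, HasDerivAt (fun t => 2 * (κ t : ℂ)) 0 t := by
    intro t
    have hline : HasDerivAt (fun s : ℝ => ((0, s) : Heis n)) (0, 1) t :=
      (hasDerivAt_const t 0).prodMk (hasDerivAt_id t)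
    have h1 := (differentiableAt_of_contDiff hLs (0, t)).hasFDerivAt.comp_hasDerivAt t hline
    have h2 := fderiv_Dt_sublaplacian hgs α hZZ hBB (0, t)
    have h3 := (h1.congr_deriv h2).sub_const
      (deriv (Z α) (deriv (fun q => (Z α q).bar) g) (0, 0) +
      deriv (fun q => (Z α q).bar) (deriv (Z α) g) (0, 0))
    refine h3.congr_of_eventuallyEq (Filter.Eventually.of_forall fun s => ?_)
    simp only [Function.comp, hlap s]
    ring
  have hode : ∀ t, v'' t + n * v' t ^ 2 = 0 := by
    intro t
    have h1 : HasDerivAt (fun t => 2 * (κ t : ℂ)) _ t := ((hκ t).ofReal_comp).const_mul 2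
    have h2 := h1.unique (hκ0 t)
    norm_cast at h2
    have h3 := Real.exp_pos (-(2 * v t))
    have h4 : (0 : ℝ) < 2 * (4 * (n + 1) * Real.exp (-(2 * v t))) := by positivity
    rw [← mul_assoc] at h2
    refine (mul_eq_zero.1 h2).resolve_left ?_
    exact_mod_cast h4.ne'
  have hn : (0 : ℝ) < n := by exact_mod_cast α.pos
  exact deriv_eq_zero_of_ode hn hv hv' hode t

end HeisenbergCR

/-! ### Solving the equations once the conformal factor is constant. -/

namespace HeisenbergCR

variable {n : ℕ} {v v' v'' : ℝ → ℝ}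

theorem fderiv_fderiv_ofReal {f : Heis n → ℝ} (hf : ContDiff ℝ ∞ f) (p V W : Heis n) :
    fderiv ℝ (fderiv ℝ fun q => (f q : ℂ)) p V W = (fderiv ℝ (fderiv ℝ f) p V W : ℂ) := by
  have h1 : (fderiv ℝ fun q => (f q : ℂ)) = fun q => toC (fderiv ℝ f q) := by
    funext q
    exact (Complex.ofRealCLM.hasFDerivAt.comp q
      (differentiableAt_of_contDiff hf q).hasFDerivAt).fderiv
  have h2 : DifferentiableAt ℝ (fderiv ℝ f) p :=
    (hf.fderiv_right (m := ∞) (by simp)).differentiable (by simp) p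
  have h3 : HasFDerivAt (fun q => toC (fderiv ℝ f q))
      ((ContinuousLinearMap.compL ℝ (Heis n) ℝ ℂ Complex.ofRealCLM).comp
        (fderiv ℝ (fderiv ℝ f) p)) p :=
    (ContinuousLinearMap.compL ℝ (Heis n) ℝ ℂ Complex.ofRealCLM).hasFDerivAt.comp p h2.hasFDerivAt
  rw [h1, h3.fderiv]
  simp

/-- If `Z Z f = 0` and `f` is affine in `t`, then `f` is a combination of `1, z_α, z̄_α, |z_α|²` in
each of the variables `z_α`. -/
theorem slice_eq {f : Heis n → ℝ} (hf : ContDiff ℝ ∞ f) (k : ℝ)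
    (ht : ∀ p, fderiv ℝ f p (0, 1) = k) (α : Fin n)
    (hZ : ∀ p, deriv (Z α) (deriv (Z α) (fun q => (f q : ℂ))) p = 0) (z : Fin n → ℂ) :
    ∃ A B C D : ℂ, ∀ w, (f (Function.update z α w, 0) : ℂ) =
      A + B * w + C * conj w + D * (w * conj w) := by
  have hd : ∀ p, DifferentiableAt ℝ (fderiv ℝ f) p :=
    (hf.fderiv_right (m := ∞) (by simp)).differentiable (by simp)
  have hsymm : ∀ p V W, fderiv ℝ (fderiv ℝ f) p V W = fderiv ℝ (fderiv ℝ f) p W V :=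
    fun p V W => (hf.contDiffAt.isSymmSndFDerivAt (by
      rw [minSmoothness_of_isRCLikeNormedField]; exact WithTop.coe_le_coe.2 le_top)).eq V W
  have happ : ∀ p W, HasFDerivAt (fun q => fderiv ℝ f q W) ((fderiv ℝ (fderiv ℝ f) p).flip W) p :=
    fun p W => by simpa using (hd p).hasFDerivAt.clm_apply (hasFDerivAt_const W p)
  have hT : ∀ p V, fderiv ℝ (fderiv ℝ f) p V (0, 1) = 0 := by
    intro p V
    have h1 := happ p (0, 1)
    rw [show (fun q => fderiv ℝ f q (0, 1)) = fun _ => k from funext ht] at h1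
    have h2 := h1.unique (hasFDerivAt_const k p)
    exact congrArg (fun L => L V) h2
  have hT' : ∀ p V, fderiv ℝ (fderiv ℝ f) p (0, 1) V = 0 := fun p V => by rw [hsymm, hT]
  set e : Heis n := (Pi.single α 1, 0) with he
  set e' : Heis n := (Pi.single α Complex.I, 0) with he'
  -- As `∂_t f` is constant, every Hessian entry involving `∂_t` vanishes; the real and imaginary
  -- parts of `Z_α Z_α f = 0` are then `f_xx = f_yy` and `f_xy = 0`.
  have hB : ∀ p, fderiv ℝ (fderiv ℝ f) p e e = fderiv ℝ (fderiv ℝ f) p e' e' ∧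
      fderiv ℝ (fderiv ℝ f) p e e' = 0 := by
    intro p
    have h1 := hZ p
    have hX : (Z α p).1 = (1 / 2 : ℝ) • e + (p.1 α).im • ((0, 1) : Heis n) := by
      refine Prod.ext (funext fun i => ?_) ?_
      · by_cases h : i = α
        · subst h; simp [Z, he]
        · simp [Z, he, h]
      · simp [Z, he]
    have hY : (Z α p).2 = (-1 / 2 : ℝ) • e' + (p.1 α).re • ((0, 1) : Heis n) := by
      refine Prod.ext (funext fun i => ?_) ?_
      · by_cases h : i = α
        · subst h; simp [Z, he']; ring
        · simp [Z, he', h]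
      · simp [Z, he']
    rw [deriv_deriv_Z (contDiff_ofReal_comp hf), ev₂, hX, hY] at h1
    simp only [fderiv_fderiv_ofReal hf, map_add, map_smul, add_apply, smul_apply, hT, hT',
      Complex.real_smul, Complex.ofReal_zero, mul_zero, add_zero] at h1
    rw [hsymm p e' e] at h1
    have hre := congrArg Complex.re h1
    have him := congrArg Complex.im h1
    simp only [Complex.add_re, Complex.sub_re, Complex.mul_re, Complex.add_im, Complex.sub_im,
      Complex.mul_im, Complex.ofReal_re, Complex.ofReal_im, Complex.I_re, Complex.I_im,
      Complex.zero_re, Complex.zero_im] at hre him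
    constructor <;> linarith
  set L : ℂ →L[ℝ] Heis n := (ContinuousLinearMap.inl ℝ (Fin n → ℂ) ℝ).comp
    (.pi (Pi.single α (.id ℝ ℂ))) with hL
  have hA : ∀ w, HasFDerivAt (fun w => ((Function.update z α w, 0) : Heis n)) L w := fun w =>
    (ContinuousLinearMap.inl ℝ (Fin n → ℂ) ℝ).hasFDerivAt.comp w (hasFDerivAt_update z w)
  have hLu : ∀ u : ℂ, L u = u.re • e + u.im • e' := by
    intro u
    refine Prod.ext (funext fun i => ?_) ?_
    · by_cases h : i = α
      · subst h; simp [hL, he, he']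
      · simp [hL, he, he', h]
    · simp [hL, he, he']
  have hmain := eq_affine_add_normSq
    (ψ := fun w => f (Function.update z α w, 0))
    (P := fun w => fderiv ℝ f (Function.update z α w, 0) e)
    (Q := fun w => fderiv ℝ f (Function.update z α w, 0) e')
    (R := fun w => fderiv ℝ (fderiv ℝ f) (Function.update z α w, 0) e e)
    (fun w => by
      refine ((differentiableAt_of_contDiff hf _).hasFDerivAt.comp w (hA w)).congr_fderiv ?_
      refine ContinuousLinearMap.ext fun u => ?_
      simp [hLu, mul_comm])
    (fun w => by
      refine ((happ _ e).comp w (hA w)).congr_fderiv ?_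
      refine ContinuousLinearMap.ext fun u => ?_
      simp [hLu, hsymm _ e' e, (hB _).2, mul_comm])
    (fun w => by
      refine ((happ _ e').comp w (hA w)).congr_fderiv ?_
      refine ContinuousLinearMap.ext fun u => ?_
      simp [hLu, (hB _).2, (hB _).1, mul_comm])
  obtain ⟨a, b, c, r, h⟩ : ∃ a b c r : ℝ, ∀ w : ℂ, f (Function.update z α w, 0) =
    a + b * w.re + c * w.im + r / 2 * Complex.normSq w := ⟨_, _, _, _, hmain⟩
  -- Rewriting `b Re w + c Im w` in terms of `w` and `w̄`.
  refine ⟨a, (b - c * Complex.I) / 2, (b + c * Complex.I) / 2, r / 2, fun w => ?_⟩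
  rw [h, Complex.mul_conj]
  have h3 : conj w = w.re - w.im * Complex.I := by
    apply Complex.ext <;> simp
  have h4 : w = w.re + w.im * Complex.I := (Complex.re_add_im _).symm
  rw [h3]
  push_cast
  linear_combination (-(b - c * Complex.I) / 2) * h4 + c * (w.im : ℂ) * Complex.I_sq

theorem IsCRYamabeSoliton.eq_integral_add (hvs : ContDiff ℝ ∞ v) {f : Heis n → ℝ} {μ : ℝ}
    (hf : IsCRYamabeSoliton (confForm n v) f μ) :
    ∃ C : (Fin n → Fin 2) → (Fin n → Fin 2) → ℂ, ∀ (z : Fin n → ℂ) (t : ℝ),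
      (f (z, t) : ℂ) = 2 * (μ : ℂ) * ((∫ s in (0 : ℝ)..t, Real.exp (2 * v s) : ℝ) : ℂ) +
        ∑ p : Fin n → Fin 2, ∑ q : Fin n → Fin 2,
          C p q * ∏ i, (z i ^ (p i : ℕ) * conj (z i) ^ (q i : ℕ)) := by
  have hv : ∀ t, HasDerivAt v (_root_.deriv v t) t := fun t =>
    (hvs.differentiable (by simp) t).hasDerivAt
  have hvs' : ContDiff ℝ ∞ (_root_.deriv v) := (contDiff_infty_iff_deriv.1 hvs).2
  have hv' : ∀ t, HasDerivAt (_root_.deriv v) (_root_.deriv (_root_.deriv v) t) t := fun t =>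
    (hvs'.differentiable (by simp) t).hasDerivAt
  have hc : Continuous (_root_.deriv (_root_.deriv v)) :=
    (contDiff_infty_iff_deriv.1 hvs').2.continuous
  have hfs : ContDiff ℝ ∞ f := hf.2.1
  have h0 := deriv_conformal_eq_zero hv hv' hvs hc hf
  have h00 : ∀ α : Fin n, ∀ t, _root_.deriv (_root_.deriv v) t = 0 := fun α t => by
    rw [show _root_.deriv v = fun _ => 0 from funext (h0 α)]
    simp
  have hT : ∀ p, fderiv ℝ f p (0, 1) = 2 * μ * Real.exp (2 * v p.2) := by
    intro p
    have h1 := hf.characteristic_pde hv hv' p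
    have h2 : -(_root_.deriv v p.2) • p.1 = 0 := by
      funext α
      simp [h0 α]
    -- The vanishing of `v'` and `v''` is available only given an index in `Fin n`, so it is used
    -- term by term inside the sum; for `n = 0` the sum is empty.
    have h3 : (_root_.deriv (_root_.deriv v) p.2 + n * _root_.deriv v p.2 ^ 2) *
        ∑ β, Complex.normSq (p.1 β) = 0 := by
      rw [Finset.mul_sum]
      refine Finset.sum_eq_zero fun β _ => ?_
      rw [h0 β, h00 β]
      ring
    rw [h2] at h1
    linear_combination h1 + 4 * (n + 1) * h3
  have hint := hasDerivAt_integral (k := fun s => Real.exp (2 * v s))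
    (by have := hvs.continuous; fun_prop)
  have hsplit : ∀ (z : Fin n → ℂ) (t : ℝ),
      f (z, t) = 2 * μ * (∫ s in (0 : ℝ)..t, Real.exp (2 * v s)) + f (z, 0) := by
    intro z t
    have h1 : ∀ t, HasDerivAt (fun t => f (z, t) -
        2 * μ * (∫ s in (0 : ℝ)..t, Real.exp (2 * v s))) 0 t := by
      intro t
      have h2 := HasFDerivAt.comp_hasDerivAt (f := fun s => ((z, s) : Heis n)) t
        (differentiableAt_of_contDiff hfs (z, t)).hasFDerivAt
        ((hasDerivAt_const t z).prodMk (hasDerivAt_id t))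
      rw [hT] at h2
      refine (h2.sub ((hint t).const_mul (2 * μ))).congr_deriv ?_
      simp
    have h2 := is_const_of_deriv_eq_zero (fun s => (h1 s).differentiableAt)
      (fun s => (h1 s).deriv) t 0
    simp only [intervalIntegral.integral_same, mul_zero, sub_zero] at h2
    linarith
  obtain ⟨C, hC⟩ := exists_coeff_of_separately_affine n (fun z => (f (z, 0) : ℂ)) (by
    intro z α
    have hconst : ∀ t, v t = v 0 := fun t =>
      is_const_of_deriv_eq_zero (fun s => (hv s).differentiableAt) (h0 α) t 0
    refine slice_eq hfs (2 * μ * Real.exp (2 * v 0)) (fun p => by rw [hT, hconst]) α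
      (fun p => ?_) z
    have h1 := hf.hess_pde hv hv' α p
    rw [h0 α, h00 α] at h1
    simpa using h1)
  refine ⟨C, fun z t => ?_⟩
  rw [hsplit z t, ← hC]
  push_cast
  ring

end HeisenbergCR

theorem corollary5p3 (n : ℕ) (u : HeisenbergCR.Heis n → ℝ) (hu : ContDiff ℝ ∞ u)
    (v : ℝ → ℝ) (huv : ∀ (z : Fin n → ℂ) (t : ℝ), u (z, t) = v t)
    (f : HeisenbergCR.Heis n → ℝ) (μ : ℝ)
    (hf : HeisenbergCR.IsCRYamabeSoliton
      (fun p => Real.exp (2 * u p) • HeisenbergCR.contactForm n p) f μ) :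
    ∃ C : (Fin n → Fin 2) → (Fin n → Fin 2) → ℂ, ∀ (z : Fin n → ℂ) (t : ℝ),
      (f (z, t) : ℂ) = 2 * (μ : ℂ) * ((∫ s in (0 : ℝ)..t, Real.exp (2 * v s) : ℝ) : ℂ) +
        ∑ p : Fin n → Fin 2, ∑ q : Fin n → Fin 2,
          C p q * ∏ i, (z i ^ (p i : ℕ) * conj (z i) ^ (q i : ℕ)) := by
  have hu' : u = fun p => v p.2 := funext fun p => huv p.1 p.2
  have hvs : ContDiff ℝ ∞ v := by
    have h : v = fun t => u (0, t) := funext fun t => (huv 0 t).symm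
    rw [h]
    exact hu.comp (contDiff_const.prodMk contDiff_id)
  subst hu'
  exact HeisenbergCR.IsCRYamabeSoliton.eq_integral_add hvs hf
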